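/- Let $I=(0,1)$, $n\in\mathbb N$, $c_p=2/\pi$, $\vec m(v)=(\cos v,\sin v)$, $D\vec m(v)=(-\sin v,\cos v)$, $D^2\vec m(v)=(-\cos v,-\sin v)$, and $H^1_{0L}(I)=\{v\in H^1(I): v(0)=0\}$, whose elements are identified with their continuous representatives on $[0,1]$. Let $\mathcal H=(\mathbb R^2)^n\times H^1_{0L}(I)\times H^1_{0L}(I)^n$ and let the admissible set $\mathcal A$ consist of all $(\vec{\mathbf h},\alpha,\boldsymbol\vartheta)\in\mathcal H$ such that, for every $i=1,\dots,n$, $\vartheta_i$ is a weak solution of $$-\vartheta_i''-\vec h_i\cdot D\vec m(\alpha+\vartheta_i)=0\ \text{ in } I,\qquad \vartheta_i(0)=\vartheta_i'(1)=0 .$$ For targets $\overline{\boldsymbol\vartheta}=(\bar\vartheta_1,\dots,\bar\vartheta_n)$ and $\varepsilon,\gamma>0$ set $$\mathcal C(\vec{\mathbf h},\alpha,\boldsymbol\vartheta)=\frac12\sum_{i=1}^n\int_0^1|\vartheta_i-\bar\vartheta_i|^2+\frac\varepsilon2\int_0^1|\alpha'|^2+\frac\gamma2\sum_{i=1}^n|\vec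 h_i|^2 ,$$ and consider, for $(\vec{\mathbf h},\alpha,\boldsymbol\vartheta,\boldsymbol\lambda)\in\mathcal H\times H^1_{0L}(I)^n$, the Lagrange system (boundary value problems understood weakly, with test functions in $H^1_{0L}(I)$) $$\text{(EQ)}\quad\begin{cases}-\vartheta_i''-\vec h_i\cdot D\vec m(\alpha+\vartheta_i)=0, & \vartheta_i(0)=\vartheta_i'(1)=0,\\ -\lambda_i''-\lambda_i\,\vec h_i\cdot D^2\vec m(\alpha+\vartheta_i)=\vartheta_i-\bar\vartheta_i, & \lambda_i(0)=\lambda_i'(1)=0,\\ -\varepsilon\alpha''+\sum_{j=1}^n\lambda_j\,\vec h_j\cdot D^2\vec m(\alpha+\vartheta_j)=0, & \alpha(0)=\alpha'(1)=0,\\ \gamma\,\vec h_i=-\int_0^1\lambda_i\,D\vec m(\alpha+\vartheta_i),\end{cases}\qquad i=1,\dots,n .$$ **Theorem.** Let $\overline{\boldsymbol\vartheta}\in C([0,1])^n$, $\varepsilon>0$ and $0<K<c_p^{-2}$. There exists $\gamma_{**}=\gamma_{**}(\overline{\boldsymbol\vartheta},\varepsilon,K)$ such that for every $\gamma>\gamma_{**}$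 the functional $\mathcal C$ has exactly one minimizer $(\vec{\mathbf h},\alpha,\boldsymbol\vartheta)$ in $\mathcal A$. Moreover there is $\boldsymbol\lambda\in H^1_{0L}(I)^n$ such that $(\vec{\mathbf h},\alpha,\boldsymbol\vartheta,\boldsymbol\lambda)$ is a solution of (EQ) with $\max_i|\vec h_i|\le K$, and it is the only solution of (EQ) in $\mathcal H\times H^1_{0L}(I)^n$ with this bound. This solution is smooth in the following sense: $\vartheta_i,\lambda_i,\alpha\in C^2([0,1])$, they satisfy the equations and the boundary conditions of (EQ) pointwise, and, for every integer $k\ge0$ such that all targets belong to $C^k([0,1])$ (in particular for $k=0$), $\alpha\in C^{k+4}([0,1])$, $\vartheta_i\in C^{k+6}([0,1])$ and $\lambda_i\in C^{k+2}([0,1])$ for all $i$. Finally $\alpha'(0)=0$ and $\|\vartheta_i\|_\infty\le|\vec h_i|$ for all $i=1,\dots,n$. -/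

import Mathlib

open Set MeasureTheory
open scoped ContDiff

noncomputable section

namespace MagneticBeam

/-- The Euclidean plane, where the applied fields and the magnetization take values. -/
abbrev Plane : Type := EuclideanSpace ℝ (Fin 2)

/-- The constant `c_p = 2 / π` of the Poincare inequality `∫ v² ≤ c_p² ∫ (v')²`, `v(0) = 0`. -/
def cp : ℝ := 2 / Real.pi

/-- First derivative of `m(v) = (cos v, sin v)`. -/
def Dm (v : ℝ) : Plane := !₂[-Real.sin v, Real.cos v]

/-- Second derivative of `m(v) = (cos v, sin v)`. -/
def D2m (v : ℝ) : Plane := !₂[-Real.cos v, -Real.sin v]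

/-- A continuous function on `[0,1]`, viewed as a function on the line (constant outside `[0,1]`;
only the values on `[0,1]` are ever used). -/
def ext (v : C(unitInterval, ℝ)) : ℝ → ℝ := IccExtend (zero_le_one (α := ℝ)) v

/-- `g` is the weak (distributional) derivative of `v` on the interval `(0,1)`. -/
def IsWeakDeriv (v g : ℝ → ℝ) : Prop :=
  ∀ φ : ℝ → ℝ, ContDiff ℝ ∞ φ → HasCompactSupport φ → tsupport φ ⊆ Ioo 0 1 →
    ∫ s in (0 : ℝ)..1, v s * deriv φ s = -∫ s in (0 : ℝ)..1, g s * φ s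

/-- The space `H¹_{0L}(0,1)` of the functions `v ∈ H¹(0,1)` with `v(0) = 0`. Its elements are
identified with their continuous representatives on `[0,1]`, so that equality in this type is
equality of Sobolev functions and `v 0` is a genuine point value. -/
def H10L : Type :=
  {v : C(unitInterval, ℝ) // v 0 = 0 ∧
    ∃ g : ℝ → ℝ, MemLp g 2 (volume.restrict (Ioo (0 : ℝ) 1)) ∧ IsWeakDeriv (ext v) g}

/-- The continuous representative, as an element of `C([0,1])` with its supremum norm. -/
def H10L.toC (v : H10L) : C(unitInterval, ℝ) := v.1

/-- The continuous representative, as a function on the line. -/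
def H10L.fn (v : H10L) : ℝ → ℝ := ext v.toC

/-- The weak derivative in `L²(0,1)` (unique up to null sets). -/
def H10L.wderiv (v : H10L) : ℝ → ℝ := v.2.2.choose

/-- The space `ℝ^{2n} × H¹_{0L} × (H¹_{0L})ⁿ` of triplets (fields, design, states). -/
@[ext]
structure Config (n : ℕ) where
  /-- the applied fields -/
  h : Fin n → Plane
  /-- the relative angle of the magnetization -/
  α : H10L
  /-- the shapes -/
  θ : Fin n → H10L

/-- `v` is a weak solution of `-v'' + F = 0` in `(0,1)`, `v(0) = 0`, `v'(1) = 0`. -/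
def WeakSol (v : H10L) (F : ℝ → ℝ) : Prop :=
  ∀ w : H10L, (∫ s in (0 : ℝ)..1, v.wderiv s * w.wderiv s) + ∫ s in (0 : ℝ)..1, F s * w.fn s = 0

/-- `v` is a classical solution of `-v'' + F = 0` in `[0,1]`, `v(0) = 0`, `v'(1) = 0`: it is of
class `C²` up to the boundary (one-sided derivatives at the end points), and the equation and both
boundary conditions hold pointwise. -/
def ClassicalSol (v : ℝ → ℝ) (F : ℝ → ℝ) : Prop :=
  ContDiffOn ℝ 2 v (Icc 0 1) ∧
  (∀ s ∈ Icc (0 : ℝ) 1, -derivWithin (derivWithin v (Icc 0 1)) (Icc 0 1) s + F s = 0) ∧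
  v 0 = 0 ∧ derivWithin v (Icc 0 1) 1 = 0

/-- Lower-order term of the state equation, `-h_i · Dm(α + θ_i)`. -/
def stateTerm {n : ℕ} (p : Config n) (i : Fin n) (s : ℝ) : ℝ :=
  -inner ℝ (p.h i) (Dm (p.α.fn s + (p.θ i).fn s))

/-- Lower-order term of the adjoint equation, `-λ_i h_i · D²m(α + θ_i) - (θ_i - θbar_i)`. -/
def adjointTerm {n : ℕ} (θbar : Fin n → C(unitInterval, ℝ)) (p : Config n) (lam : Fin n → H10L)
    (i : Fin n) (s : ℝ) : ℝ :=
  -((lam i).fn s * inner ℝ (p.h i) (D2m (p.α.fn s + (p.θ i).fn s)))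
    - ((p.θ i).fn s - ext (θbar i) s)

/-- Lower-order term of the design equation divided by `ε`,
`(1/ε) ∑ λ_i h_i · D²m(α + θ_i)`. -/
def designTerm {n : ℕ} (ε : ℝ) (p : Config n) (lam : Fin n → H10L) (s : ℝ) : ℝ :=
  (1 / ε) * ∑ i, (lam i).fn s * inner ℝ (p.h i) (D2m (p.α.fn s + (p.θ i).fn s))

/-- The optimality condition for the fields, `γ h_i = -∫ λ_i Dm(α + θ_i)` for every `i`. -/
def FieldEq {n : ℕ} (γ : ℝ) (p : Config n) (lam : Fin n → H10L) : Prop :=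
  ∀ i, γ • p.h i = -∫ s in (0 : ℝ)..1, (lam i).fn s • Dm (p.α.fn s + (p.θ i).fn s)

/-- The admissible set: the triplets such that every `θ_i` solves its state equation. -/
def admissible (n : ℕ) : Set (Config n) :=
  {p | ∀ i, WeakSol (p.θ i) (stateTerm p i)}

/-- The cost functional `C_{ε,γ}` with targets `θbar`. -/
def cost {n : ℕ} (θbar : Fin n → C(unitInterval, ℝ)) (ε γ : ℝ) (p : Config n) : ℝ :=
  (1 / 2) * ∑ i, (∫ s in (0 : ℝ)..1, |(p.θ i).fn s - ext (θbar i) s| ^ 2)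
    + ε / 2 * (∫ s in (0 : ℝ)..1, |p.α.wderiv s| ^ 2)
    + γ / 2 * ∑ i, ‖p.h i‖ ^ 2

/-- `p` minimizes the cost functional over the admissible set. -/
def IsMinimizer {n : ℕ} (θbar : Fin n → C(unitInterval, ℝ)) (ε γ : ℝ) (p : Config n) : Prop :=
  p ∈ admissible n ∧ ∀ q ∈ admissible n, cost θbar ε γ p ≤ cost θbar ε γ q

/-- `(p, lam)` solves the Lagrange system, the boundary value problems being understood weakly. -/
def SolvesLagrange {n : ℕ} (θbar : Fin n → C(unitInterval, ℝ)) (ε γ : ℝ) (p : Config n)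
    (lam : Fin n → H10L) : Prop :=
  (∀ i, WeakSol (p.θ i) (stateTerm p i)) ∧
  (∀ i, WeakSol (lam i) (adjointTerm θbar p lam i)) ∧
  WeakSol p.α (designTerm ε p lam) ∧
  FieldEq γ p lam

/-- `(p, lam)` solves the Lagrange system classically. -/
def SolvesLagrangeClassically {n : ℕ} (θbar : Fin n → C(unitInterval, ℝ)) (ε γ : ℝ)
    (p : Config n) (lam : Fin n → H10L) : Prop :=
  (∀ i, ClassicalSol (p.θ i).fn (stateTerm p i)) ∧
  (∀ i, ClassicalSol (lam i).fn (adjointTerm θbar p lam i)) ∧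
  ClassicalSol p.α.fn (designTerm ε p lam) ∧
  FieldEq γ p lam

end MagneticBeam

end

open MagneticBeam

/-!
The boundary value problem `-v'' + F = 0`, `v(0) = v'(1) = 0` is inverted explicitly by integrating
twice (`green`); weak solutions with continuous data are exactly the functions `green (-F)`
(`WeakSol.eq_green`, `weakSol_of_eq_green`). This rests on the fundamental theorem of calculus in
`H¹(0,1)`, obtained from the du Bois-Reymond lemma (`eq_const_of_integral_deriv_test`,
`H10L.fn_eq_integral`), and makes the regularity statements a bootstrap, since `green` gains two
derivatives.

Both minimality and uniqueness come from one inequality, with no compactness or differentiation of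
the control-to-state map. Let `(p, λ)` solve the Lagrange system with `|h_i| ≤ K`.

* As `K < c_p⁻²`, comparison with a supersolution of the adjoint equation bounds `λ` by a constant
  `M` that does not depend on `γ` (`exists_comparison_bound`, `exists_multiplier_bound`). The
  optimality condition for the fields then forces `|h_i| ≤ M / γ`.
* For an admissible `q`, expand `cost q - cost p`, using `λ` as a test function in the state
  equations of `q`. All first-order terms cancel. The second-order remainder of the state equation
  is at most `M (|δh| |σ| + 3 |h| σ²)` with `σ = δα + δθ`, so that for large `γ` it is absorbed by
  the quadratic terms of the cost (`cost_quadratic_growth`).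

Hence every such solution is a strict global minimizer (`SolvesLagrange.eq_of_cost_le`): two of them
have the same configuration, and then the same multipliers (`multiplier_unique`).

A solution exists for `γ` large by the contraction principle (`exists_solvesLagrange`). After the
rescaling `h = r u` with a small `r` independent of `γ`, the coupling terms are small, and the only
one that is not, the dependence of `λ` on `θ`, has Lipschitz constant `1 / 2`.

The condition `α'(0) = 0` says that the source of the design equation has zero mean, which follows
from the optimality condition for the fields
(`SolvesLagrange.hasDerivWithinAt_design_zero`).
-/

namespace MagneticBeam

/-! ### Weak derivatives on the unit interval -/

theorem integral_mul_eq_of_hasDerivAt {g φ φ' : ℝ → ℝ} (hg : IntervalIntegrable g volume 0 1)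
    (hφ : ∀ x, HasDerivAt φ (φ' x) x) (hφ' : Continuous φ') :
    ∫ s in (0 : ℝ)..1, g s * φ s =
      (∫ s in (0 : ℝ)..1, g s) * φ 1 - ∫ s in (0 : ℝ)..1, (∫ t in (0 : ℝ)..s, g t) * φ' s := by
  have hd : deriv φ = φ' := funext fun x => (hφ x).deriv
  have hf := hg.absolutelyContinuousOnInterval_intervalIntegral (c := 0) (by simp)
  have hφc : ContDiff ℝ 1 φ :=
    contDiff_one_iff_deriv.2 ⟨fun x => (hφ x).differentiableAt, hd ▸ hφ'⟩
  have key := hf.integral_mul_deriv_eq_deriv_mul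
    (hφc.contDiffOn (s := uIcc 0 1)).absolutelyContinuousOnInterval
  have hcongr : ∫ x in (0 : ℝ)..1, deriv (fun x => ∫ t in (0 : ℝ)..x, g t) x * φ x =
      ∫ x in (0 : ℝ)..1, g x * φ x := by
    apply intervalIntegral.integral_congr_ae
    filter_upwards [hg.ae_hasDerivAt_integral] with x hx hx'
    rw [(hx (uIoc_subset_uIcc hx') 0 (by simp)).deriv]
  simp only [hd, hcongr, intervalIntegral.integral_same, zero_mul, sub_zero] at key
  linarith

theorem exists_Icc_of_isCompact {s : Set ℝ} (hs : IsCompact s) (hs' : s ⊆ Ioo 0 1) :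
    ∃ a b, 0 < a ∧ b < 1 ∧ s ⊆ Icc a b := by
  rcases s.eq_empty_or_nonempty with rfl | hne
  · exact ⟨1 / 2, 1 / 2, by norm_num, by norm_num, empty_subset _⟩
  · obtain ⟨a, ha, ha'⟩ := hs.exists_isLeast hne
    obtain ⟨b, hb, hb'⟩ := hs.exists_isGreatest hne
    exact ⟨a, b, (hs' ha).1, (hs' hb).2, fun x hx => ⟨ha' hx, hb' hx⟩⟩

/-- A test function with zero mean is the derivative of a test function. -/
theorem exists_test_antideriv {χ : ℝ → ℝ} (hχ : ContDiff ℝ ∞ χ) (hc : HasCompactSupport χ)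
    (hs : tsupport χ ⊆ Ioo 0 1) (h0 : ∫ s in (0 : ℝ)..1, χ s = 0) :
    ∃ φ : ℝ → ℝ, ContDiff ℝ ∞ φ ∧ HasCompactSupport φ ∧ tsupport φ ⊆ Ioo 0 1 ∧ deriv φ = χ := by
  obtain ⟨a, b, ha, hb, hab⟩ := exists_Icc_of_isCompact hc hs
  have hz : ∀ t, t ∉ Icc a b → χ t = 0 := fun t ht => image_eq_zero_of_notMem_tsupport
    fun h => ht (hab h)
  have hd : ∀ x, HasDerivAt (fun x => ∫ t in (0 : ℝ)..x, χ t) (χ x) x := fun x =>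
    intervalIntegral.integral_hasDerivAt_right (hχ.continuous.intervalIntegrable _ _)
      (hχ.continuous.stronglyMeasurableAtFilter _ _) hχ.continuous.continuousAt
  have hderiv : deriv (fun x => ∫ t in (0 : ℝ)..x, χ t) = χ := funext fun x => (hd x).deriv
  have hsub : tsupport (fun x => ∫ t in (0 : ℝ)..x, χ t) ⊆ Icc a b := by
    refine closure_minimal (fun x hx => ?_) isClosed_Icc
    by_contra hxab
    refine hx ?_
    change ∫ t in (0 : ℝ)..x, χ t = 0
    rcases lt_or_ge x a with h | h
    · rw [intervalIntegral.integral_congr (g := fun _ => (0 : ℝ)), intervalIntegral.integral_zero]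
      intro t ht
      have : t ≤ max 0 x := (mem_uIcc.1 ht).elim (fun h => h.2.trans (le_max_right _ _))
        fun h => h.2.trans (le_max_left _ _)
      exact hz t fun h' => absurd h'.1 (not_le.2 (this.trans_lt (max_lt ha h)))
    · have hxb : b < x := not_le.1 fun h' => hxab ⟨h, h'⟩
      have : ∫ t in (1 : ℝ)..x, χ t = 0 := by
        rw [intervalIntegral.integral_congr (g := fun _ => (0 : ℝ)), intervalIntegral.integral_zero]
        intro t ht
        have : min 1 x ≤ t := (mem_uIcc.1 ht).elim (fun h => (min_le_left _ _).trans h.1)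
          fun h => (min_le_right _ _).trans h.1
        exact hz t fun h' => absurd h'.2 (not_le.2 ((lt_min hb hxb).trans_le this))
      rw [← intervalIntegral.integral_add_adjacent_intervals
        (hχ.continuous.intervalIntegrable 0 1) (hχ.continuous.intervalIntegrable 1 x), h0, this,
        add_zero]
  refine ⟨_, ?_, HasCompactSupport.of_support_subset_isCompact isCompact_Icc
    ((subset_tsupport _).trans hsub), hsub.trans fun x hx => ⟨ha.trans_le hx.1, hx.2.trans_lt hb⟩,
    hderiv⟩
  exact contDiff_infty_iff_deriv.2 ⟨fun x => (hd x).differentiableAt, by rwa [hderiv]⟩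

theorem integral_congr_Icc {f g : ℝ → ℝ} (h : ∀ x ∈ Icc (0 : ℝ) 1, f x = g x) :
    ∫ s in (0 : ℝ)..1, f s = ∫ s in (0 : ℝ)..1, g s :=
  intervalIntegral.integral_congr fun x hx => h x (by rwa [uIcc_of_le zero_le_one] at hx)

/-- The integral of a function supported in the open unit interval is its integral from `0`
to `1`. -/
theorem integral_eq_of_tsupport_subset {f : ℝ → ℝ} (hs : tsupport f ⊆ Ioo 0 1) :
    ∫ x, f x = ∫ s in (0 : ℝ)..1, f s := by
  rw [intervalIntegral.integral_of_le zero_le_one]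
  exact (setIntegral_eq_integral_of_forall_compl_eq_zero fun x hx =>
    image_eq_zero_of_notMem_tsupport fun h => hx (Ioo_subset_Ioc_self (hs h))).symm

theorem ae_eq_zero_of_integral_test {f : ℝ → ℝ} (hf : IntervalIntegrable f volume 0 1)
    (h : ∀ φ : ℝ → ℝ, ContDiff ℝ ∞ φ → HasCompactSupport φ → tsupport φ ⊆ Ioo 0 1 →
      ∫ s in (0 : ℝ)..1, f s * φ s = 0) :
    ∀ᵐ x, x ∈ Ioo (0 : ℝ) 1 → f x = 0 := by
  refine isOpen_Ioo.ae_eq_zero_of_integral_contDiff_smul_eq_zero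
    (((intervalIntegrable_iff_integrableOn_Ioo_of_le zero_le_one).1 hf).locallyIntegrableOn)
    fun φ h1 h2 h3 => ?_
  rw [integral_eq_of_tsupport_subset]
  · simpa only [smul_eq_mul, mul_comm] using h φ h1 h2 h3
  · exact (tsupport_smul_subset_left φ f).trans h3

/-- The du Bois-Reymond lemma for continuous functions: a continuous function with zero weak
derivative is constant. -/
theorem eq_const_of_integral_deriv_test {V : ℝ → ℝ} (hV : ContinuousOn V (Icc 0 1))
    (h : ∀ φ : ℝ → ℝ, ContDiff ℝ ∞ φ → HasCompactSupport φ → tsupport φ ⊆ Ioo 0 1 →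
      ∫ s in (0 : ℝ)..1, V s * deriv φ s = 0) :
    ∃ c, ∀ x ∈ Icc (0 : ℝ) 1, V x = c := by
  have hVi : IntervalIntegrable V volume 0 1 :=
    ContinuousOn.intervalIntegrable (by rwa [uIcc_of_le zero_le_one])
  have hVm : ∀ {φ : ℝ → ℝ}, Continuous φ →
      IntervalIntegrable (fun s => V s * φ s) volume 0 1 := fun hφ =>
    hVi.mul_continuousOn hφ.continuousOn
  let B : ContDiffBump (1 / 2 : ℝ) := ⟨1 / 8, 1 / 4, by norm_num, by norm_num⟩
  set ρ : ℝ → ℝ := B.normed volume with hρ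
  have hρs : tsupport ρ ⊆ Ioo 0 1 := by
    rw [hρ, B.tsupport_normed_eq, Real.closedBall_eq_Icc]
    intro x hx
    have h1 : (1 / 2 : ℝ) - 1 / 4 ≤ x := hx.1
    have h2 : x ≤ (1 / 2 : ℝ) + 1 / 4 := hx.2
    constructor <;> linarith
  have hρc : ContDiff ℝ ∞ ρ := B.contDiff_normed
  have hρ1 : ∫ s in (0 : ℝ)..1, ρ s = 1 := by
    rw [← integral_eq_of_tsupport_subset hρs, hρ, B.integral_normed]
  refine ⟨∫ s in (0 : ℝ)..1, V s * ρ s, ?_⟩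
  set c := ∫ s in (0 : ℝ)..1, V s * ρ s with hcdef
  have hae : ∀ᵐ x, x ∈ Ioo (0 : ℝ) 1 → V x - c = 0 := by
    refine ae_eq_zero_of_integral_test (hVi.sub intervalIntegrable_const) fun ψ h1 h2 h3 => ?_
    set m := ∫ s in (0 : ℝ)..1, ψ s with hm
    -- subtracting a multiple of the bump turns `ψ` into the derivative of a test function
    obtain ⟨φ, p1, p2, p3, p4⟩ := exists_test_antideriv (χ := ψ - m • ρ)
      (h1.sub (hρc.const_smul m)) (h2.sub (B.hasCompactSupport_normed.smul_left (f := fun _ => m)))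
      ((tsupport_sub _ _).trans (union_subset h3 ((tsupport_smul_subset_right (fun _ => m) ρ).trans
        hρs))) (by
        simp only [Pi.sub_apply, Pi.smul_apply, smul_eq_mul]
        rw [intervalIntegral.integral_sub (h1.continuous.intervalIntegrable _ _)
          ((hρc.continuous.const_mul m).intervalIntegrable _ _),
          intervalIntegral.integral_const_mul, hρ1]
        ring)
    have := h φ p1 p2 p3
    rw [p4] at this
    have e1 : ∀ s, V s * (ψ - m • ρ) s = V s * ψ s - m * (V s * ρ s) := fun s => by
      simp only [Pi.sub_apply, Pi.smul_apply, smul_eq_mul]; ring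
    simp only [e1] at this
    rw [intervalIntegral.integral_sub (hVm h1.continuous) ((hVm hρc.continuous).const_mul m),
      intervalIntegral.integral_const_mul] at this
    have e2 : ∀ s, (V s - c) * ψ s = V s * ψ s - c * ψ s := fun s => by ring
    simp only [e2]
    rw [intervalIntegral.integral_sub (hVm h1.continuous)
      ((h1.continuous.const_mul c).intervalIntegrable _ _), intervalIntegral.integral_const_mul]
    linarith
  have hEq : EqOn V (fun _ => c) (Ioo 0 1) := by
    refine Measure.eqOn_open_of_ae_eq (μ := volume) ?_ isOpen_Ioo
      (hV.mono Ioo_subset_Icc_self) continuousOn_const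
    rw [Filter.EventuallyEq, ae_restrict_iff' measurableSet_Ioo]
    filter_upwards [hae] with x hx hx'
    linarith [hx hx']
  have := hEq.of_subset_closure hV continuousOn_const Ioo_subset_Icc_self
    (by rw [closure_Ioo zero_ne_one])
  exact fun x hx => this hx

theorem continuous_ext (v : C(unitInterval, ℝ)) : Continuous (ext v) := v.continuous.Icc_extend'

theorem ext_of_mem (v : C(unitInterval, ℝ)) {x : ℝ} (hx : x ∈ Icc (0 : ℝ) 1) :
    ext v x = v ⟨x, hx⟩ := IccExtend_of_mem _ _ hx

theorem abs_ext_le (v : C(unitInterval, ℝ)) (x : ℝ) : |ext v x| ≤ ‖v‖ :=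
  v.norm_coe_le_norm _

theorem intervalIntegrable_of_memLp {g : ℝ → ℝ}
    (hg : MemLp g 2 (volume.restrict (Ioo (0 : ℝ) 1))) :
    IntervalIntegrable g volume 0 1 :=
  (intervalIntegrable_iff_integrableOn_Ioo_of_le zero_le_one).2 (hg.integrable one_le_two)

theorem intervalIntegrable_mul_of_memLp {f g : ℝ → ℝ}
    (hf : MemLp f 2 (volume.restrict (Ioo (0 : ℝ) 1)))
    (hg : MemLp g 2 (volume.restrict (Ioo (0 : ℝ) 1))) :
    IntervalIntegrable (fun s => f s * g s) volume 0 1 :=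
  (intervalIntegrable_iff_integrableOn_Ioo_of_le zero_le_one).2 (hf.integrable_mul hg)

theorem continuousOn_primitive_Icc {g : ℝ → ℝ} (hg : IntervalIntegrable g volume 0 1) :
    ContinuousOn (fun x => ∫ t in (0 : ℝ)..x, g t) (Icc 0 1) := by
  have := intervalIntegral.continuousOn_primitive_interval' hg (a := 0) (by simp)
  rwa [uIcc_of_le zero_le_one] at this

/-- If `v` is a primitive of `g`, then `g` is the weak derivative of `v`. -/
theorem isWeakDeriv_of_primitive {v g : ℝ → ℝ} (hg : IntervalIntegrable g volume 0 1)
    (h : ∀ x ∈ Icc (0 : ℝ) 1, v x = ∫ t in (0 : ℝ)..x, g t) : IsWeakDeriv v g := by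
  intro φ h1 _ h3
  have hφ1 : φ 1 = 0 := image_eq_zero_of_notMem_tsupport fun h => lt_irrefl _ (h3 h).2
  rw [integral_mul_eq_of_hasDerivAt hg (fun x => (h1.differentiable (by simp) x).hasDerivAt)
    (h1.continuous_deriv (by simp)), hφ1,
    integral_congr_Icc fun x hx => by rw [h x hx]]
  ring

theorem IsWeakDeriv.ae_eq {v f g : ℝ → ℝ} (hf : IntervalIntegrable f volume 0 1)
    (hg : IntervalIntegrable g volume 0 1) (h1 : IsWeakDeriv v f) (h2 : IsWeakDeriv v g) :
    ∀ᵐ x, x ∈ Ioo (0 : ℝ) 1 → f x = g x := by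
  have := ae_eq_zero_of_integral_test (hf.sub hg) fun φ p1 p2 p3 => by
    have e : ∀ s, (f s - g s) * φ s = f s * φ s - g s * φ s := fun s => by ring
    simp only [e]
    rw [intervalIntegral.integral_sub (hf.mul_continuousOn p1.continuous.continuousOn)
      (hg.mul_continuousOn p1.continuous.continuousOn)]
    linarith [h1 φ p1 p2 p3, h2 φ p1 p2 p3]
  filter_upwards [this] with x hx hx'
  linarith [hx hx']

namespace H10L

theorem continuous_fn (v : H10L) : Continuous v.fn := continuous_ext _

theorem memLp_wderiv (v : H10L) : MemLp v.wderiv 2 (volume.restrict (Ioo (0 : ℝ) 1)) :=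
  v.2.2.choose_spec.1

theorem isWeakDeriv_wderiv (v : H10L) : IsWeakDeriv v.fn v.wderiv := v.2.2.choose_spec.2

theorem intervalIntegrable_wderiv (v : H10L) : IntervalIntegrable v.wderiv volume 0 1 :=
  intervalIntegrable_of_memLp v.memLp_wderiv

theorem fn_zero (v : H10L) : v.fn 0 = 0 :=
  (ext_of_mem v.toC (left_mem_Icc.2 zero_le_one)).trans v.2.1

theorem ext_fn {v w : H10L} (h : ∀ x ∈ Icc (0 : ℝ) 1, v.fn x = w.fn x) : v = w := by
  refine Subtype.ext (ContinuousMap.ext fun x => ?_)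
  have := h x x.2
  rwa [H10L.fn, H10L.fn, ext_of_mem _ x.2, ext_of_mem _ x.2] at this

/-- The fundamental theorem of calculus in `H¹(0,1)`. -/
theorem fn_eq_integral (v : H10L) {x : ℝ} (hx : x ∈ Icc (0 : ℝ) 1) :
    v.fn x = ∫ t in (0 : ℝ)..x, v.wderiv t := by
  have hi := v.intervalIntegrable_wderiv
  have hP := continuousOn_primitive_Icc hi
  obtain ⟨c, hc⟩ := eq_const_of_integral_deriv_test (V := fun x => v.fn x - ∫ t in (0 : ℝ)..x,
    v.wderiv t) (v.continuous_fn.continuousOn.sub hP) fun φ p1 p2 p3 => by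
      have a1 := v.isWeakDeriv_wderiv φ p1 p2 p3
      have a2 := isWeakDeriv_of_primitive hi (fun _ _ => rfl) φ p1 p2 p3
      have hφ' : Continuous (deriv φ) := p1.continuous_deriv (by simp)
      simp only [sub_mul]
      have i1 : IntervalIntegrable (fun s => v.fn s * deriv φ s) volume 0 1 :=
        (v.continuous_fn.mul hφ').intervalIntegrable _ _
      have i2 : IntervalIntegrable (fun s => (∫ t in (0 : ℝ)..s, v.wderiv t) * deriv φ s)
          volume 0 1 := by
        refine ContinuousOn.intervalIntegrable ?_
        rw [uIcc_of_le zero_le_one]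
        exact hP.mul hφ'.continuousOn
      rw [intervalIntegral.integral_sub i1 i2, a1, a2, sub_self]
  have h0 := hc 0 (by simp)
  have h1 := hc x hx
  simp only [v.fn_zero, intervalIntegral.integral_same] at h0
  linarith

theorem eq_of_wderiv_ae {v w : H10L} (h : ∀ᵐ x, x ∈ Ioo (0 : ℝ) 1 → v.wderiv x = w.wderiv x) :
    v = w := by
  refine ext_fn fun x hx => ?_
  rw [v.fn_eq_integral hx, w.fn_eq_integral hx]
  refine intervalIntegral.integral_congr_ae ?_
  have h1 : ∀ᵐ x : ℝ, x ≠ 1 := by simp [ae_iff, measure_singleton]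
  filter_upwards [h, h1] with t ht ht1 htx
  rw [uIoc_of_le hx.1] at htx
  exact ht ⟨htx.1, lt_of_le_of_ne (htx.2.trans hx.2) ht1⟩

theorem wderiv_ae_eq_of_primitive {v : H10L} {g : ℝ → ℝ} (hg : IntervalIntegrable g volume 0 1)
    (hv : ∀ x ∈ Icc (0 : ℝ) 1, v.fn x = ∫ t in (0 : ℝ)..x, g t) :
    ∀ᵐ x, x ∈ uIoc (0 : ℝ) 1 → v.wderiv x = g x := by
  have h1 : ∀ᵐ x : ℝ, x ≠ 1 := by simp [ae_iff, measure_singleton]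
  filter_upwards [v.isWeakDeriv_wderiv.ae_eq v.intervalIntegrable_wderiv hg
    (isWeakDeriv_of_primitive hg hv), h1] with x hx hx1 hx'
  rw [uIoc_of_le zero_le_one] at hx'
  exact hx ⟨hx'.1, lt_of_le_of_ne hx'.2 hx1⟩

end H10L

end MagneticBeam

namespace MagneticBeam

/-! ### The Green operator of the mixed boundary value problem -/

/-- The solution `v` of `-v'' = f` in `(0,1)`, `v(0) = 0`, `v'(1) = 0`, obtained by integrating
twice. -/
noncomputable def green (f : ℝ → ℝ) (x : ℝ) : ℝ := ∫ t in (0 : ℝ)..x, ∫ s in t..1, f s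

section Green

variable {f g : ℝ → ℝ}

theorem hasDerivAt_tail (hf : Continuous f) (x : ℝ) :
    HasDerivAt (fun x => ∫ s in x..1, f s) (-f x) x :=
  intervalIntegral.integral_hasDerivAt_left (hf.intervalIntegrable _ _)
    (hf.stronglyMeasurableAtFilter _ _) hf.continuousAt

theorem continuous_tail (hf : Continuous f) : Continuous fun x => ∫ s in x..1, f s :=
  continuous_iff_continuousAt.2 fun x => (hasDerivAt_tail hf x).continuousAt

theorem hasDerivAt_green (hf : Continuous f) (x : ℝ) :
    HasDerivAt (green f) (∫ s in x..1, f s) x :=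
  intervalIntegral.integral_hasDerivAt_right ((continuous_tail hf).intervalIntegrable _ _)
    ((continuous_tail hf).stronglyMeasurableAtFilter _ _) (continuous_tail hf).continuousAt

theorem continuous_green (hf : Continuous f) : Continuous (green f) :=
  continuous_iff_continuousAt.2 fun x => (hasDerivAt_green hf x).continuousAt

theorem green_zero (f : ℝ → ℝ) : green f 0 = 0 := intervalIntegral.integral_same

theorem green_congr (h : ∀ x ∈ Icc (0 : ℝ) 1, f x = g x) {x : ℝ} (hx : x ∈ Icc (0 : ℝ) 1) :
    green f x = green g x := by
  refine intervalIntegral.integral_congr fun t ht => intervalIntegral.integral_congr fun s hs => ?_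
  rw [uIcc_of_le hx.1] at ht
  rw [uIcc_of_le (ht.2.trans hx.2)] at hs
  exact h s ⟨ht.1.trans hs.1, hs.2⟩

/-- The Green operator is positive, hence preserves pointwise bounds. -/
theorem abs_green_le (hf : Continuous f) (hg : Continuous g)
    (h : ∀ x ∈ Icc (0 : ℝ) 1, |f x| ≤ g x) {x : ℝ} (hx : x ∈ Icc (0 : ℝ) 1) :
    |green f x| ≤ green g x := by
  refine (intervalIntegral.abs_integral_le_integral_abs hx.1).trans ?_
  refine intervalIntegral.integral_mono_on hx.1
    ((continuous_tail hf).abs.intervalIntegrable _ _)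
    ((continuous_tail hg).intervalIntegrable _ _) fun t ht => ?_
  have ht1 : t ≤ 1 := ht.2.trans hx.2
  refine (intervalIntegral.abs_integral_le_integral_abs ht1).trans ?_
  exact intervalIntegral.integral_mono_on ht1 (hf.abs.intervalIntegrable _ _)
    (hg.intervalIntegrable _ _) fun s hs => h s ⟨ht.1.trans hs.1, hs.2⟩

theorem green_sub (hf : Continuous f) (hg : Continuous g) (x : ℝ) :
    green (fun s => f s - g s) x = green f x - green g x := by
  unfold green
  rw [← intervalIntegral.integral_sub ((continuous_tail hf).intervalIntegrable _ _)
    ((continuous_tail hg).intervalIntegrable _ _)]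
  refine intervalIntegral.integral_congr fun t _ => ?_
  exact intervalIntegral.integral_sub (hf.intervalIntegrable _ _) (hg.intervalIntegrable _ _)

theorem green_add (hf : Continuous f) (hg : Continuous g) (x : ℝ) :
    green (fun s => f s + g s) x = green f x + green g x := by
  unfold green
  rw [← intervalIntegral.integral_add ((continuous_tail hf).intervalIntegrable _ _)
    ((continuous_tail hg).intervalIntegrable _ _)]
  refine intervalIntegral.integral_congr fun t _ => ?_
  exact intervalIntegral.integral_add (hf.intervalIntegrable _ _) (hg.intervalIntegrable _ _)

theorem green_const_mul (c : ℝ) (f : ℝ → ℝ) (x : ℝ) :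
    green (fun s => c * f s) x = c * green f x := by
  simp only [green, intervalIntegral.integral_const_mul]

theorem green_const (c x : ℝ) : green (fun _ => c) x = c * (x - x ^ 2 / 2) := by
  have h : ∀ t, (∫ _ in t..1, c) = c * (1 - t) := fun t => by
    rw [intervalIntegral.integral_const, smul_eq_mul, mul_comm]
  simp only [green, h]
  rw [intervalIntegral.integral_const_mul, intervalIntegral.integral_sub
    (continuous_const.intervalIntegrable _ _) (continuous_id'.intervalIntegrable _ _)]
  simp

theorem abs_green_le_half (hf : Continuous f) {c : ℝ} (h : ∀ x ∈ Icc (0 : ℝ) 1, |f x| ≤ c) {x : ℝ}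
    (hx : x ∈ Icc (0 : ℝ) 1) : |green f x| ≤ c / 2 := by
  have hc : 0 ≤ c := (abs_nonneg _).trans (h x hx)
  refine (abs_green_le hf continuous_const h hx).trans ?_
  rw [green_const]
  nlinarith [sq_nonneg (1 - x)]

/-- `cos (k (1 - x))` solves `-v'' = k² v`, `v'(1) = 0`; its value at `0` is subtracted to meet the
condition at `0`. -/
theorem green_cos {k : ℝ} (hk : k ≠ 0) (x : ℝ) :
    green (fun s => Real.cos (k * (1 - s))) x =
      (Real.cos (k * (1 - x)) - Real.cos k) / k ^ 2 := by
  have hin : ∀ s : ℝ, HasDerivAt (fun s => k * (1 - s)) (-k) s := fun s => by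
    simpa using ((hasDerivAt_id s).const_sub 1).const_mul k
  have h1 : ∀ t : ℝ, (∫ s in t..1, Real.cos (k * (1 - s))) = Real.sin (k * (1 - t)) / k := by
    intro t
    rw [intervalIntegral.integral_eq_sub_of_hasDerivAt
      (f := fun s => -Real.sin (k * (1 - s)) / k)]
    · simp; ring
    · intro s _
      convert! ((hin s).sin.neg.div_const k) using 1
      rw [eq_div_iff hk]
      ring
    · exact (by fun_prop : Continuous fun s => Real.cos (k * (1 - s))).intervalIntegrable _ _
  simp only [green, h1]
  rw [intervalIntegral.integral_eq_sub_of_hasDerivAt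
    (f := fun s => Real.cos (k * (1 - s)) / k ^ 2)]
  · simp; ring
  · intro s _
    convert! ((hin s).cos.div_const (k ^ 2)) using 1
    rw [div_eq_div_iff hk (pow_ne_zero 2 hk)]
    ring
  · exact (by fun_prop : Continuous fun s => Real.sin (k * (1 - s)) / k).intervalIntegrable _ _

theorem exists_sq_between {K : ℝ} (hKcp : K < (cp ^ 2)⁻¹) :
    ∃ k, 0 < k ∧ k < Real.pi / 2 ∧ K < k ^ 2 := by
  have h1 : (cp ^ 2)⁻¹ = (Real.pi / 2) ^ 2 := by rw [cp, ← inv_pow, inv_div]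
  have hs : √K < Real.pi / 2 := by
    rw [Real.sqrt_lt' (by positivity), ← h1]; exact hKcp
  obtain ⟨k, hk1, hk2⟩ := exists_between hs
  have hk0 : 0 < k := (Real.sqrt_nonneg K).trans_lt hk1
  exact ⟨k, hk0, hk2, (Real.sqrt_lt' hk0).1 hk1⟩

/-- Below the first eigenvalue `c_p⁻²` the operator `-v'' - b v`, `|b| ≤ K`, has a uniformly bounded
inverse in the supremum norm. The bound comes from comparison with the positive supersolution
`cos (k (1 - x))`, `K < k ^ 2 < c_p⁻²`, evaluated where the ratio is largest. -/
theorem exists_comparison_bound {K : ℝ} (hK : 0 < K) (hKcp : K < (cp ^ 2)⁻¹) :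
    ∃ C, 0 < C ∧ ∀ (R : ℝ) (v f : ℝ → ℝ), Continuous f →
      (∀ x ∈ Icc (0 : ℝ) 1, v x = green f x) → (∀ x ∈ Icc (0 : ℝ) 1, |f x| ≤ K * |v x| + R) →
      ∀ x ∈ Icc (0 : ℝ) 1, |v x| ≤ C * R := by
  obtain ⟨k, hk0, hk1, hk2⟩ := exists_sq_between hKcp
  have hcos : 0 < Real.cos k := Real.cos_pos_of_mem_Ioo ⟨by linarith, hk1⟩
  have hδ : 0 < 1 - K / k ^ 2 := by
    rw [sub_pos, div_lt_one (by positivity)]; exact hk2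
  refine ⟨(2 * Real.cos k * (1 - K / k ^ 2))⁻¹, by positivity, fun R v f hf hv hfb => ?_⟩
  set φ : ℝ → ℝ := fun x => Real.cos (k * (1 - x)) with hφ
  have hφc : Continuous φ := by fun_prop
  have hφge : ∀ x ∈ Icc (0 : ℝ) 1, Real.cos k ≤ φ x := fun x hx =>
    Real.cos_le_cos_of_nonneg_of_le_pi (mul_nonneg hk0.le (by linarith [hx.2]))
      (by linarith [Real.pi_pos]) (by nlinarith [hx.1])
  have hvc : ContinuousOn v (Icc 0 1) := (continuous_green hf).continuousOn.congr hv
  obtain ⟨x₀, hx₀, hmax⟩ := isCompact_Icc.exists_isMaxOn (nonempty_Icc.2 zero_le_one)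
    (hvc.abs.div hφc.continuousOn fun x hx => (hcos.trans_le (hφge x hx)).ne')
  set m := |v x₀| / φ x₀ with hm
  have hφ0 : 0 < φ x₀ := hcos.trans_le (hφge x₀ hx₀)
  have hm0 : 0 ≤ m := by positivity
  have hvm : ∀ x ∈ Icc (0 : ℝ) 1, |v x| ≤ m * φ x := fun x hx =>
    (div_le_iff₀ (hcos.trans_le (hφge x hx))).1 (hmax hx)
  have hb := abs_green_le hf (g := fun x => K * m * φ x + R) (by fun_prop) (fun x hx =>
    (hfb x hx).trans (by nlinarith [hvm x hx])) hx₀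
  have hR : 0 ≤ K * |v 0| + R := (abs_nonneg _).trans (hfb 0 (by simp))
  have hR' : 0 ≤ R := by
    rw [hv 0 (by simp), green_zero] at hR
    simpa using hR
  rw [green_add (by fun_prop) continuous_const, green_const_mul, green_const, hφ,
    green_cos hk0.ne', ← hv x₀ hx₀] at hb
  have hb2 : |v x₀| = m * φ x₀ := (div_mul_cancel₀ _ hφ0.ne').symm
  have hb3 : K * m * ((Real.cos (k * (1 - x₀)) - Real.cos k) / k ^ 2) ≤ K / k ^ 2 * (m * φ x₀) := by
    have : 0 ≤ K * m * Real.cos k / k ^ 2 := by positivity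
    have e : K * m * ((Real.cos (k * (1 - x₀)) - Real.cos k) / k ^ 2) =
      K / k ^ 2 * (m * φ x₀) - K * m * Real.cos k / k ^ 2 := by simp only [hφ]; ring
    linarith
  have hb4 : R * (x₀ - x₀ ^ 2 / 2) ≤ R / 2 := by nlinarith [sq_nonneg (1 - x₀)]
  have hb5 : m * φ x₀ * (1 - K / k ^ 2) ≤ R / 2 := by linarith
  have hb6 : m * (2 * Real.cos k * (1 - K / k ^ 2)) ≤ R := by
    have : m * Real.cos k * (1 - K / k ^ 2) ≤ m * φ x₀ * (1 - K / k ^ 2) := by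
      gcongr; exact hφge x₀ hx₀
    linarith
  have hb7 : m ≤ (2 * Real.cos k * (1 - K / k ^ 2))⁻¹ * R := by
    rw [inv_mul_eq_div, le_div_iff₀ (by positivity)]; exact hb6
  intro x hx
  exact ((hvm x hx).trans (mul_le_of_le_one_right hm0 (Real.cos_le_one _))).trans hb7

end Green

/-! ### Weak and classical solutions -/

section Regularity

variable {f : ℝ → ℝ}

theorem derivWithin_Icc_eq {u u' : ℝ → ℝ} (h : ∀ x, HasDerivAt u (u' x) x) {x : ℝ}
    (hx : x ∈ Icc (0 : ℝ) 1) : derivWithin u (Icc 0 1) x = u' x :=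
  (h x).hasDerivWithinAt.derivWithin (uniqueDiffOn_Icc zero_lt_one x hx)

theorem contDiffOn_succ_of_hasDerivAt {u u' : ℝ → ℝ} {k : ℕ} (h : ∀ x, HasDerivAt u (u' x) x)
    (hu' : ContDiffOn ℝ k u' (Icc 0 1)) : ContDiffOn ℝ ((k + 1 : ℕ) : WithTop ℕ∞) u (Icc 0 1) := by
  rw [Nat.cast_add, Nat.cast_one, contDiffOn_succ_iff_derivWithin (uniqueDiffOn_Icc zero_lt_one)]
  exact ⟨fun x _ => (h x).differentiableAt.differentiableWithinAt, fun h => by simp at h,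
    hu'.congr fun x hx => derivWithin_Icc_eq h hx⟩

/-- The Green operator gains two derivatives. -/
theorem contDiffOn_green (hf : Continuous f) {k : ℕ} (h : ContDiffOn ℝ k f (Icc 0 1)) :
    ContDiffOn ℝ ((k + 2 : ℕ) : WithTop ℕ∞) (green f) (Icc 0 1) :=
  contDiffOn_succ_of_hasDerivAt (hasDerivAt_green hf)
    (contDiffOn_succ_of_hasDerivAt (hasDerivAt_tail hf) h.neg)

/-- `green f` as an element of `H¹_{0L}(0,1)`. -/
noncomputable def greenH (f : ℝ → ℝ) (hf : Continuous f) : H10L :=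
  ⟨⟨fun x => green f x, (continuous_green hf).comp continuous_subtype_val⟩, green_zero f,
    fun x => ∫ s in x..1, f s, by
      have : IsFiniteMeasure (volume.restrict (Ioo (0 : ℝ) 1)) := ⟨by simp⟩
      obtain ⟨C, hC⟩ := isCompact_Icc.exists_bound_of_continuousOn (s := Icc (0 : ℝ) 1)
        (continuous_tail hf).continuousOn
      refine MemLp.of_bound (continuous_tail hf).aestronglyMeasurable C ?_
      exact (ae_restrict_iff' measurableSet_Ioo).2
        (Filter.Eventually.of_forall fun x hx => hC x (Ioo_subset_Icc_self hx)),
    isWeakDeriv_of_primitive ((continuous_tail hf).intervalIntegrable _ _)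
      fun x hx => ext_of_mem _ hx⟩

theorem greenH_fn (hf : Continuous f) {x : ℝ} (hx : x ∈ Icc (0 : ℝ) 1) :
    (greenH f hf).fn x = green f x := ext_of_mem _ hx

theorem weakSol_of_eq_green {v : H10L} {F : ℝ → ℝ} (hF : Continuous F)
    (h : ∀ x ∈ Icc (0 : ℝ) 1, v.fn x = green (fun s => -F s) x) : WeakSol v F := by
  intro w
  have hF' : Continuous fun s => -F s := hF.neg
  have h1 := H10L.wderiv_ae_eq_of_primitive ((continuous_tail hF').intervalIntegrable 0 1) h
  have h2 : ∫ s in (0 : ℝ)..1, v.wderiv s * w.wderiv s =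
      ∫ s in (0 : ℝ)..1, w.wderiv s * ∫ t in s..1, -F t := by
    refine intervalIntegral.integral_congr_ae ?_
    filter_upwards [h1] with x hx hx'
    rw [hx hx', mul_comm]
  rw [h2, integral_mul_eq_of_hasDerivAt w.intervalIntegrable_wderiv (hasDerivAt_tail hF')
    hF'.neg, intervalIntegral.integral_same, mul_zero, zero_sub,
    neg_add_eq_zero]
  refine integral_congr_Icc fun x hx => ?_
  rw [← w.fn_eq_integral hx]
  ring

/-- Weak solutions with continuous data are given by the Green operator. Testing the equation for
the difference of two weak solutions with the difference itself shows uniqueness. -/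
theorem WeakSol.eq_green {v : H10L} {F : ℝ → ℝ} (hF : Continuous F) (h : WeakSol v F) {x : ℝ}
    (hx : x ∈ Icc (0 : ℝ) 1) : v.fn x = green (fun s => -F s) x := by
  have hF' : Continuous fun s => -F s := hF.neg
  set u := greenH _ hF' with hu
  have hw : WeakSol u F := weakSol_of_eq_green hF fun x hx => greenH_fn hF' hx
  have hd : MemLp (fun s => v.wderiv s - u.wderiv s) 2 (volume.restrict (Ioo (0 : ℝ) 1)) :=
    v.memLp_wderiv.sub u.memLp_wderiv
  have hz : ∫ s in (0 : ℝ)..1, (v.wderiv s - u.wderiv s) * (v.wderiv s - u.wderiv s) = 0 := by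
    have i (a b : H10L) := intervalIntegrable_mul_of_memLp a.memLp_wderiv b.memLp_wderiv
    have e : ∀ s, (v.wderiv s - u.wderiv s) * (v.wderiv s - u.wderiv s) =
        (v.wderiv s * v.wderiv s - u.wderiv s * v.wderiv s) -
        (v.wderiv s * u.wderiv s - u.wderiv s * u.wderiv s) := fun s => by ring
    simp only [e]
    rw [intervalIntegral.integral_sub ((i v v).sub (i u v)) ((i v u).sub (i u u)),
      intervalIntegral.integral_sub (i v v) (i u v), intervalIntegral.integral_sub (i v u) (i u u)]
    linarith [h v, h u, hw v, hw u]
  have hvu : v = u := by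
    refine H10L.eq_of_wderiv_ae ?_
    rw [intervalIntegral.integral_of_le zero_le_one, integral_Ioc_eq_integral_Ioo,
      integral_eq_zero_iff_of_nonneg (fun s => mul_self_nonneg _) (hd.integrable_mul hd),
      Filter.EventuallyEq, ae_restrict_iff' measurableSet_Ioo] at hz
    filter_upwards [hz] with x hx hx'
    exact sub_eq_zero.1 (mul_self_eq_zero.1 (hx hx'))
  rw [hvu, hu, greenH_fn hF' hx]

theorem WeakSol.contDiffOn {v : H10L} {F : ℝ → ℝ} (hF : Continuous F) (h : WeakSol v F) {k : ℕ}
    (hk : ContDiffOn ℝ k F (Icc 0 1)) : ContDiffOn ℝ ((k + 2 : ℕ) : WithTop ℕ∞) v.fn (Icc 0 1) :=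
  (contDiffOn_green hF.neg hk.neg).congr fun _ hx => h.eq_green hF hx

theorem WeakSol.hasDerivWithinAt {v : H10L} {F : ℝ → ℝ} (hF : Continuous F) (h : WeakSol v F)
    {x : ℝ} (hx : x ∈ Icc (0 : ℝ) 1) :
    HasDerivWithinAt v.fn (∫ s in x..1, -F s) (Icc 0 1) x :=
  (hasDerivAt_green hF.neg x).hasDerivWithinAt.congr (fun _ hy => h.eq_green hF hy)
    (h.eq_green hF hx)

theorem WeakSol.classicalSol {v : H10L} {F : ℝ → ℝ} (hF : Continuous F) (h : WeakSol v F) :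
    ClassicalSol v.fn F := by
  have hd : ∀ x ∈ Icc (0 : ℝ) 1, derivWithin v.fn (Icc 0 1) x = ∫ s in x..1, -F s := fun x hx =>
    (h.hasDerivWithinAt hF hx).derivWithin (uniqueDiffOn_Icc zero_lt_one x hx)
  refine ⟨by simpa using h.contDiffOn (k := 0) hF (by simpa using hF.continuousOn),
    fun x hx => ?_, v.fn_zero, by simp [hd 1 (by simp)]⟩
  have hF' : Continuous fun s => -F s := hF.neg
  rw [derivWithin_congr hd (hd x hx), derivWithin_Icc_eq (hasDerivAt_tail hF') hx]
  ring

end Regularity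

/-- The Cauchy-Schwarz bound of a primitive by the `L²` norm of its derivative. -/
theorem sq_primitive_le {g : ℝ → ℝ} (hg : MemLp g 2 (volume.restrict (Ioo (0 : ℝ) 1))) {x : ℝ}
    (hx : x ∈ Icc (0 : ℝ) 1) : (∫ t in (0 : ℝ)..x, g t) ^ 2 ≤ ∫ t in (0 : ℝ)..1, g t ^ 2 := by
  have hsub : uIcc 0 x ⊆ uIcc (0 : ℝ) 1 := by
    rw [uIcc_of_le hx.1, uIcc_of_le zero_le_one]; exact Icc_subset_Icc_right hx.2
  have i2 : IntervalIntegrable (fun s => g s ^ 2) volume 0 1 := by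
    simpa only [sq] using intervalIntegrable_mul_of_memLp hg hg
  have i1 := (intervalIntegrable_of_memLp hg).mono_set hsub
  have i2' := i2.mono_set hsub
  set c := ∫ t in (0 : ℝ)..x, g t with hc
  have h0 : 0 ≤ ∫ t in (0 : ℝ)..x, (g t ^ 2 - 2 * c * g t + c ^ 2) :=
    intervalIntegral.integral_nonneg hx.1 fun t _ => by nlinarith [sq_nonneg (g t - c)]
  rw [intervalIntegral.integral_add (i2'.sub (i1.const_mul _)) intervalIntegrable_const,
    intervalIntegral.integral_sub i2' (i1.const_mul _), intervalIntegral.integral_const_mul, ← hc,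
    intervalIntegral.integral_const, smul_eq_mul] at h0
  have h1 : ∫ t in (0 : ℝ)..x, g t ^ 2 ≤ ∫ t in (0 : ℝ)..1, g t ^ 2 :=
    intervalIntegral.integral_mono_interval le_rfl hx.1 hx.2
      (Filter.Eventually.of_forall fun t => sq_nonneg _) i2
  nlinarith [sq_nonneg c, hx.2]

theorem H10L.sq_sub_le (v w : H10L) {x : ℝ} (hx : x ∈ Icc (0 : ℝ) 1) :
    (v.fn x - w.fn x) ^ 2 ≤ ∫ s in (0 : ℝ)..1, (v.wderiv s - w.wderiv s) ^ 2 := by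
  have hsub : uIcc 0 x ⊆ uIcc (0 : ℝ) 1 := by
    rw [uIcc_of_le hx.1, uIcc_of_le zero_le_one]; exact Icc_subset_Icc_right hx.2
  rw [v.fn_eq_integral hx, w.fn_eq_integral hx, ← intervalIntegral.integral_sub
    (v.intervalIntegrable_wderiv.mono_set hsub) (w.intervalIntegrable_wderiv.mono_set hsub)]
  exact sq_primitive_le (v.memLp_wderiv.sub w.memLp_wderiv) hx

end MagneticBeam

namespace MagneticBeam

/-! ### The magnetization -/

theorem inner_Dm (h : Plane) (v : ℝ) : inner ℝ h (Dm v) = -h 0 * Real.sin v + h 1 * Real.cos v := by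
  simp [Dm, PiLp.inner_apply, Fin.sum_univ_two]
  ring

theorem D2m_eq (v : ℝ) : D2m v = Dm (v + Real.pi / 2) := by
  simp [D2m, Dm, Real.sin_add_pi_div_two, Real.cos_add_pi_div_two]

theorem norm_Dm (v : ℝ) : ‖Dm v‖ = 1 := by
  simp [Dm, EuclideanSpace.norm_eq, Fin.sum_univ_two]

theorem norm_D2m (v : ℝ) : ‖D2m v‖ = 1 := by rw [D2m_eq, norm_Dm]

theorem norm_Dm_sub_le (a b : ℝ) : ‖Dm a - Dm b‖ ≤ |a - b| := by
  rw [EuclideanSpace.norm_eq, Fin.sum_univ_two]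
  refine Real.sqrt_le_iff.2 ⟨abs_nonneg _, ?_⟩
  simp only [Dm, PiLp.sub_apply, Real.norm_eq_abs, sq_abs, Matrix.cons_val_zero,
    Matrix.cons_val_one, Matrix.cons_val_fin_one]
  have h1 := Real.one_sub_sq_div_two_le_cos (x := a - b)
  rw [Real.cos_sub] at h1
  nlinarith [Real.sin_sq_add_cos_sq a, Real.sin_sq_add_cos_sq b]

theorem norm_D2m_sub_le (a b : ℝ) : ‖D2m a - D2m b‖ ≤ |a - b| := by
  simpa [D2m_eq] using norm_Dm_sub_le (a + Real.pi / 2) (b + Real.pi / 2)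

theorem continuous_Dm : Continuous Dm :=
  (LipschitzWith.of_dist_le_mul (K := 1) fun a b => by
    simpa [dist_eq_norm] using norm_Dm_sub_le a b).continuous

theorem continuous_D2m : Continuous D2m :=
  (LipschitzWith.of_dist_le_mul (K := 1) fun a b => by
    simpa [dist_eq_norm] using norm_D2m_sub_le a b).continuous

theorem abs_inner_Dm_le (h : Plane) (v : ℝ) : |inner ℝ h (Dm v)| ≤ ‖h‖ := by
  simpa [norm_Dm] using abs_real_inner_le_norm h (Dm v)

theorem abs_inner_D2m_le (h : Plane) (v : ℝ) : |inner ℝ h (D2m v)| ≤ ‖h‖ := by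
  simpa [norm_D2m] using abs_real_inner_le_norm h (D2m v)

theorem inner_Dm_add (h : Plane) (a t : ℝ) :
    inner ℝ h (Dm (a + t)) = Real.cos t * inner ℝ h (Dm a) + Real.sin t * inner ℝ h (D2m a) := by
  rw [D2m_eq, inner_Dm, inner_Dm, inner_Dm, Real.sin_add_pi_div_two, Real.cos_add_pi_div_two,
    Real.sin_add, Real.cos_add]
  ring

theorem abs_sin_sub_self_le (t : ℝ) : |Real.sin t - t| ≤ 2 * t ^ 2 := by
  wlog ht : 0 ≤ t generalizing t
  · have := this (-t) (by linarith)
    rw [Real.sin_neg, neg_sq, ← abs_neg] at this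
    convert! this using 2
    ring
  rcases le_or_gt t 1 with h1 | h1
  · rcases ht.eq_or_lt with rfl | h0
    · simp
    · have := Real.sin_gt_sub_cube h0
      have h3 := Real.sin_lt h0
      rw [abs_le]
      constructor <;> nlinarith [mul_nonneg ht (sub_nonneg.2 h1), pow_pos h0 3, pow_pos h0 2]
  · rw [abs_le]
    constructor <;> nlinarith [Real.neg_one_le_sin t, Real.sin_le_one t]

/-- Second-order Taylor estimate. -/
theorem abs_inner_Dm_taylor (h : Plane) (a t : ℝ) :
    |inner ℝ h (Dm (a + t)) - inner ℝ h (Dm a) - inner ℝ h (D2m a) * t| ≤ 3 * ‖h‖ * t ^ 2 := by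
  rw [inner_Dm_add]
  have e : Real.cos t * inner ℝ h (Dm a) + Real.sin t * inner ℝ h (D2m a) - inner ℝ h (Dm a) -
      inner ℝ h (D2m a) * t =
      (Real.cos t - 1) * inner ℝ h (Dm a) + (Real.sin t - t) * inner ℝ h (D2m a) := by ring
  rw [e]
  refine (abs_add_le _ _).trans ?_
  rw [abs_mul, abs_mul]
  have h1 : |Real.cos t - 1| ≤ t ^ 2 / 2 := by
    rw [abs_le]
    constructor <;> nlinarith [Real.one_sub_sq_div_two_le_cos (x := t), Real.cos_le_one t]
  have h2 := mul_le_mul h1 (abs_inner_Dm_le h a) (abs_nonneg _) (by positivity)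
  have h3 := mul_le_mul (abs_sin_sub_self_le t) (abs_inner_D2m_le h a) (abs_nonneg _)
    (by positivity)
  nlinarith [mul_nonneg (norm_nonneg h) (sq_nonneg t)]

/-! ### A priori bounds for solutions of the Lagrange system -/

section Lagrange

variable {n : ℕ} {θbar : Fin n → C(unitInterval, ℝ)} {ε γ : ℝ} {p q : Config n}
  {lam mu : Fin n → H10L}

theorem continuous_angle (p : Config n) (i : Fin n) :
    Continuous fun s => p.α.fn s + (p.θ i).fn s :=
  p.α.continuous_fn.add (p.θ i).continuous_fn

theorem continuous_inner_Dm (k : Plane) (p : Config n) (i : Fin n) :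
    Continuous fun s => (inner ℝ k (Dm (p.α.fn s + (p.θ i).fn s)) : ℝ) :=
  continuous_const.inner (continuous_Dm.comp (continuous_angle p i))

theorem continuous_inner_D2m (k : Plane) (p : Config n) (i : Fin n) :
    Continuous fun s => (inner ℝ k (D2m (p.α.fn s + (p.θ i).fn s)) : ℝ) :=
  continuous_const.inner (continuous_D2m.comp (continuous_angle p i))

theorem continuous_stateTerm (p : Config n) (i : Fin n) : Continuous (stateTerm p i) :=
  (continuous_inner_Dm _ p i).neg

theorem continuous_adjointTerm (θbar : Fin n → C(unitInterval, ℝ)) (p : Config n)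
    (lam : Fin n → H10L) (i : Fin n) : Continuous (adjointTerm θbar p lam i) :=
  (((lam i).continuous_fn.mul (continuous_inner_D2m _ p i)).neg).sub
    ((p.θ i).continuous_fn.sub (continuous_ext _))

theorem continuous_designTerm (ε : ℝ) (p : Config n) (lam : Fin n → H10L) :
    Continuous (designTerm ε p lam) :=
  continuous_const.mul (continuous_finsetSum _ fun i _ =>
    (lam i).continuous_fn.mul (continuous_inner_D2m _ p i))

theorem FieldEq.inner_eq (h : FieldEq γ p lam) (k : Plane) (i : Fin n) :
    γ * inner ℝ k (p.h i) =
      -∫ s in (0 : ℝ)..1, (lam i).fn s * inner ℝ k (Dm (p.α.fn s + (p.θ i).fn s)) := by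
  have hc : Continuous fun s => (lam i).fn s • Dm (p.α.fn s + (p.θ i).fn s) :=
    (lam i).continuous_fn.smul (continuous_Dm.comp (continuous_angle p i))
  have h2 := (innerSL ℝ k).intervalIntegral_comp_comm (hc.intervalIntegrable (μ := volume) 0 1)
  simp only [innerSL_apply_apply, inner_smul_right] at h2
  rw [h2, ← inner_neg_right, ← h i, inner_smul_right]

theorem FieldEq.norm_le (h : FieldEq γ p lam) (hγ : 0 < γ) {M : ℝ} {i : Fin n}
    (hM : ∀ x ∈ Icc (0 : ℝ) 1, |(lam i).fn x| ≤ M) : γ * ‖p.h i‖ ≤ M := by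
  have h1 : γ * ‖p.h i‖ = ‖γ • p.h i‖ := by rw [norm_smul, Real.norm_of_nonneg hγ.le]
  rw [h1, h i, norm_neg]
  refine (intervalIntegral.norm_integral_le_of_norm_le_const (C := M) fun x hx => ?_).trans
    (by simp)
  rw [norm_smul, norm_Dm, mul_one]
  rw [uIoc_of_le zero_le_one] at hx
  exact hM x (Ioc_subset_Icc_self hx)

theorem abs_state_le {i : Fin n} (h : WeakSol (p.θ i) (stateTerm p i)) {x : ℝ}
    (hx : x ∈ Icc (0 : ℝ) 1) : |(p.θ i).fn x| ≤ ‖p.h i‖ / 2 := by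
  rw [h.eq_green (continuous_stateTerm p i) hx]
  refine abs_green_le_half (continuous_stateTerm p i).fun_neg (fun s _ => ?_) hx
  rw [stateTerm, neg_neg]
  exact abs_inner_Dm_le _ _

theorem norm_state_le {i : Fin n} (h : WeakSol (p.θ i) (stateTerm p i)) :
    ‖(p.θ i).toC‖ ≤ ‖p.h i‖ := by
  refine (ContinuousMap.norm_le _ (norm_nonneg _)).2 fun x => ?_
  have h1 := abs_state_le h x.2
  rw [H10L.fn, ext_of_mem _ x.2] at h1
  exact h1.trans (half_le_self (norm_nonneg _))

theorem abs_target_le (θbar : Fin n → C(unitInterval, ℝ)) (i : Fin n) (x : ℝ) :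
    |ext (θbar i) x| ≤ ‖θbar‖ :=
  (abs_ext_le _ _).trans (norm_le_pi_norm θbar i)

/-- The multipliers are bounded uniformly with respect to `γ`. -/
theorem exists_multiplier_bound (θbar : Fin n → C(unitInterval, ℝ)) {K : ℝ} (hK : 0 < K)
    (hKcp : K < (cp ^ 2)⁻¹) :
    ∃ M, 0 < M ∧ ∀ (ε γ : ℝ) (p : Config n) (lam : Fin n → H10L), SolvesLagrange θbar ε γ p lam →
      (∀ i, ‖p.h i‖ ≤ K) → ∀ i, ∀ x ∈ Icc (0 : ℝ) 1, |(lam i).fn x| ≤ M := by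
  obtain ⟨C, hC, hbound⟩ := exists_comparison_bound hK hKcp
  refine ⟨C * (K / 2 + ‖θbar‖), by positivity, fun ε γ p lam hL hp i => ?_⟩
  refine hbound _ _ _ (continuous_adjointTerm θbar p lam i).fun_neg
    (fun x hx => (hL.2.1 i).eq_green (continuous_adjointTerm θbar p lam i) hx) fun x hx => ?_
  have e : -adjointTerm θbar p lam i x =
      (lam i).fn x * inner ℝ (p.h i) (D2m (p.α.fn x + (p.θ i).fn x)) +
        ((p.θ i).fn x - ext (θbar i) x) := by
    rw [adjointTerm]; ring
  rw [e]
  refine (abs_add_le _ _).trans (add_le_add ?_ ((abs_sub _ _).trans (add_le_add ?_ ?_)))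
  · rw [abs_mul, mul_comm]
    gcongr
    exact (abs_inner_D2m_le _ _).trans (hp i)
  · exact (abs_state_le (hL.1 i) hx).trans (by linarith [hp i])
  · exact abs_target_le θbar i x

/-- The adjoint state is determined by the fields, the design and the states. -/
theorem multiplier_unique {K : ℝ} (hK : 0 < K) (hKcp : K < (cp ^ 2)⁻¹)
    (h1 : ∀ i, WeakSol (lam i) (adjointTerm θbar p lam i))
    (h2 : ∀ i, WeakSol (mu i) (adjointTerm θbar p mu i)) (hp : ∀ i, ‖p.h i‖ ≤ K) : mu = lam := by
  obtain ⟨C, hC, hbound⟩ := exists_comparison_bound hK hKcp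
  refine funext fun i => H10L.ext_fn fun x hx => ?_
  have hc1 := continuous_adjointTerm θbar p lam i
  have hc2 := continuous_adjointTerm θbar p mu i
  have := hbound 0 (fun x => (mu i).fn x - (lam i).fn x)
    (fun s => -adjointTerm θbar p mu i s - -adjointTerm θbar p lam i s) (hc2.fun_neg.fun_sub hc1.fun_neg)
    (fun x hx => by
      rw [green_sub hc2.fun_neg hc1.fun_neg, (h1 i).eq_green hc1 hx, (h2 i).eq_green hc2 hx])
    (fun x hx => by
      have e : -adjointTerm θbar p mu i x - -adjointTerm θbar p lam i x =
          inner ℝ (p.h i) (D2m (p.α.fn x + (p.θ i).fn x)) * ((mu i).fn x - (lam i).fn x) := by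
        rw [adjointTerm, adjointTerm]; ring
      rw [e, abs_mul, add_zero]
      gcongr
      exact (abs_inner_D2m_le _ _).trans (hp i)) x hx
  rw [mul_zero] at this
  exact sub_eq_zero.1 (abs_nonpos_iff.1 this)

/-! ### Solutions of the Lagrange system are strict global minimizers -/

/-- The remainder of the expansion is absorbed by the tracking and the field terms. -/
theorem remainder_lower_bound {γ M l k h β η E : ℝ} (hγ : 0 < γ) (hl : |l| ≤ M)
    (hh : γ * h ≤ M) (hMγ : 32 * M ^ 2 ≤ γ)
    (hEb : |E| ≤ k * |β + η| + 3 * h * (β + η) ^ 2) :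
    (1 / 4) * η ^ 2 - γ / 4 * k ^ 2 - 8 * M ^ 2 / γ * β ^ 2 ≤ (1 / 2) * η ^ 2 + l * E := by
  have hM0 : 0 ≤ M := (abs_nonneg _).trans hl
  have hlE : -(M * (k * |β + η| + 3 * h * (β + η) ^ 2)) ≤ l * E := by
    have := mul_le_mul hl hEb (abs_nonneg _) hM0
    rw [← abs_mul] at this
    linarith [neg_abs_le (l * E)]
  have hY1 : M * (k * |β + η|) ≤ γ / 4 * k ^ 2 + M ^ 2 / γ * (β + η) ^ 2 := by
    have : 0 ≤ (γ / 2 * k - M * |β + η|) ^ 2 / γ := by positivity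
    have e : (γ / 2 * k - M * |β + η|) ^ 2 / γ =
        γ / 4 * k ^ 2 - M * (k * |β + η|) + M ^ 2 / γ * |β + η| ^ 2 := by
      field_simp; ring
    rw [e, sq_abs] at this
    linarith
  have hY2 : M * (3 * h * (β + η) ^ 2) ≤ 3 * (M ^ 2 / γ) * (β + η) ^ 2 := by
    have : M * h ≤ M ^ 2 / γ := by
      rw [le_div_iff₀ hγ]; nlinarith
    nlinarith [sq_nonneg (β + η)]
  have hδ : M ^ 2 / γ ≤ 1 / 32 := by rw [div_le_iff₀ hγ]; linarith
  have hδ0 : 0 ≤ M ^ 2 / γ := by positivity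
  have hσ : (β + η) ^ 2 ≤ 2 * β ^ 2 + 2 * η ^ 2 := by nlinarith [sq_nonneg (β - η)]
  have e8 : 8 * M ^ 2 / γ = 8 * (M ^ 2 / γ) := by ring
  rw [e8]
  nlinarith [sq_nonneg β, sq_nonneg η, mul_le_mul_of_nonneg_left hσ hδ0,
    mul_le_mul_of_nonneg_right hδ (sq_nonneg η)]

/-- The Lagrangian expansion for the `i`-th state: testing the state equations with the multiplier
and the adjoint equation with the states leaves, besides the first-order terms in the design and in
the field, only quadratic remainders. -/
theorem tracking_lower_bound (hγ : 0 < γ) {M : ℝ} (hL : SolvesLagrange θbar ε γ p lam)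
    (hM : ∀ i, ∀ x ∈ Icc (0 : ℝ) 1, |(lam i).fn x| ≤ M) (hMγ : 32 * M ^ 2 ≤ γ)
    (hq : q ∈ admissible n) (i : Fin n) :
    (1 / 4) * (∫ s in (0 : ℝ)..1, ((q.θ i).fn s - (p.θ i).fn s) ^ 2)
      - γ / 4 * ‖q.h i - p.h i‖ ^ 2
      - 8 * M ^ 2 / γ * (∫ s in (0 : ℝ)..1, (q.α.fn s - p.α.fn s) ^ 2) ≤
    (1 / 2) * (∫ s in (0 : ℝ)..1, |(q.θ i).fn s - ext (θbar i) s| ^ 2)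
      - (1 / 2) * (∫ s in (0 : ℝ)..1, |(p.θ i).fn s - ext (θbar i) s| ^ 2)
      - (∫ s in (0 : ℝ)..1, (lam i).fn s * inner ℝ (p.h i) (D2m (p.α.fn s + (p.θ i).fn s)) *
          (q.α.fn s - p.α.fn s))
      + γ * inner ℝ (q.h i - p.h i) (p.h i) := by
  have cq := (q.θ i).continuous_fn
  have cp' := (p.θ i).continuous_fn
  have cl := (lam i).continuous_fn
  have cb := continuous_ext (θbar i)
  have caq := q.α.continuous_fn
  have cap := p.α.continuous_fn
  have cA := continuous_adjointTerm θbar p lam i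
  have cSp := continuous_stateTerm p i
  have cSq := continuous_stateTerm q i
  have cD2 := continuous_inner_D2m (p.h i) p i
  have cDk := continuous_inner_Dm (q.h i - p.h i) p i
  have ii : ∀ {f : ℝ → ℝ}, Continuous f → IntervalIntegrable f volume 0 1 := fun hf =>
    hf.intervalIntegrable _ _
  -- the differential equations, tested
  have hadj : (∫ s in (0 : ℝ)..1, adjointTerm θbar p lam i s * ((q.θ i).fn s - (p.θ i).fn s)) =
      ∫ s in (0 : ℝ)..1, (stateTerm q i s - stateTerm p i s) * (lam i).fn s := by
    simp only [mul_sub, sub_mul]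
    rw [intervalIntegral.integral_sub (ii (cA.fun_mul cq)) (ii (cA.fun_mul cp')),
      intervalIntegral.integral_sub (ii (cSq.fun_mul cl)) (ii (cSp.fun_mul cl))]
    have a1 := hL.2.1 i (q.θ i)
    have a2 := hL.2.1 i (p.θ i)
    have a3 := hL.1 i (lam i)
    have a4 := hq i (lam i)
    simp only [mul_comm ((lam i).wderiv _)] at a1 a2
    linarith
  have hfield := hL.2.2.2.inner_eq (q.h i - p.h i) i
  have hX : ∫ s in (0 : ℝ)..1, ((1 / 2) * |(q.θ i).fn s - ext (θbar i) s| ^ 2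
      - (1 / 2) * |(p.θ i).fn s - ext (θbar i) s| ^ 2
      + adjointTerm θbar p lam i s * ((q.θ i).fn s - (p.θ i).fn s)
      - (stateTerm q i s - stateTerm p i s) * (lam i).fn s
      - (lam i).fn s * inner ℝ (p.h i) (D2m (p.α.fn s + (p.θ i).fn s)) *
          (q.α.fn s - p.α.fn s)
      - (lam i).fn s * inner ℝ (q.h i - p.h i) (Dm (p.α.fn s + (p.θ i).fn s))) =
    (1 / 2) * (∫ s in (0 : ℝ)..1, |(q.θ i).fn s - ext (θbar i) s| ^ 2)
      - (1 / 2) * (∫ s in (0 : ℝ)..1, |(p.θ i).fn s - ext (θbar i) s| ^ 2)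
      - (∫ s in (0 : ℝ)..1, (lam i).fn s * inner ℝ (p.h i) (D2m (p.α.fn s + (p.θ i).fn s)) *
          (q.α.fn s - p.α.fn s))
      + γ * inner ℝ (q.h i - p.h i) (p.h i) := by
    rw [intervalIntegral.integral_sub (ii (by fun_prop)) (ii (by fun_prop)),
      intervalIntegral.integral_sub (ii (by fun_prop)) (ii (by fun_prop)),
      intervalIntegral.integral_sub (ii (by fun_prop)) (ii (by fun_prop)),
      intervalIntegral.integral_add (ii (by fun_prop)) (ii (by fun_prop)),
      intervalIntegral.integral_sub (ii (by fun_prop)) (ii (by fun_prop)),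
      intervalIntegral.integral_const_mul, intervalIntegral.integral_const_mul, hadj, hfield]
    ring
  have hY : ∫ s in (0 : ℝ)..1, ((1 / 4) * ((q.θ i).fn s - (p.θ i).fn s) ^ 2
      - γ / 4 * ‖q.h i - p.h i‖ ^ 2 - 8 * M ^ 2 / γ * (q.α.fn s - p.α.fn s) ^ 2) =
      (1 / 4) * (∫ s in (0 : ℝ)..1, ((q.θ i).fn s - (p.θ i).fn s) ^ 2)
      - γ / 4 * ‖q.h i - p.h i‖ ^ 2
      - 8 * M ^ 2 / γ * (∫ s in (0 : ℝ)..1, (q.α.fn s - p.α.fn s) ^ 2) := by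
    rw [intervalIntegral.integral_sub (ii (by fun_prop)) (ii (by fun_prop)),
      intervalIntegral.integral_sub (ii (by fun_prop)) (ii (by fun_prop)),
      intervalIntegral.integral_const_mul, intervalIntegral.integral_const_mul,
      intervalIntegral.integral_const]
    simp
  rw [← hX, ← hY]
  refine intervalIntegral.integral_mono_on zero_le_one (ii (by fun_prop)) (ii (by fun_prop))
    fun s hs => ?_
  have hl := hM i s hs
  have hh : γ * ‖p.h i‖ ≤ M := hL.2.2.2.norm_le hγ (hM i)
  set k := q.h i - p.h i with hk
  have hqh : q.h i = p.h i + k := by rw [hk]; abel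
  set a := p.α.fn s + (p.θ i).fn s with ha
  set η := (q.θ i).fn s - (p.θ i).fn s with hη
  set β := q.α.fn s - p.α.fn s with hβ
  have hb : q.α.fn s + (q.θ i).fn s = a + (β + η) := by rw [ha, hη, hβ]; ring
  set l := (lam i).fn s with hl'
  -- the remainder of the state equation
  set E : ℝ := (inner ℝ k (Dm (a + (β + η))) - inner ℝ k (Dm a)) +
    (inner ℝ (p.h i) (Dm (a + (β + η))) - inner ℝ (p.h i) (Dm a) -
      inner ℝ (p.h i) (D2m a) * (β + η)) with hE
  have hEb : |E| ≤ ‖k‖ * |β + η| + 3 * ‖p.h i‖ * (β + η) ^ 2 := by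
    refine (abs_add_le _ _).trans (add_le_add ?_ (abs_inner_Dm_taylor _ _ _))
    rw [← inner_sub_right]
    refine (abs_real_inner_le_norm _ _).trans ?_
    gcongr
    simpa using norm_Dm_sub_le (a + (β + η)) a
  have hid : (1 / 2) * |(q.θ i).fn s - ext (θbar i) s| ^ 2
      - (1 / 2) * |(p.θ i).fn s - ext (θbar i) s| ^ 2
      + adjointTerm θbar p lam i s * η
      - (stateTerm q i s - stateTerm p i s) * l
      - l * inner ℝ (p.h i) (D2m a) * β - l * inner ℝ k (Dm a) = (1 / 2) * η ^ 2 + l * E := by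
    have hθq : (q.θ i).fn s = (p.θ i).fn s + η := by rw [hη]; ring
    rw [sq_abs, sq_abs, adjointTerm, stateTerm, stateTerm, hb, hqh, inner_add_left, ← ha, ← hl', hE,
      hθq]
    ring
  rw [hid]
  exact remainder_lower_bound hγ hl hh hMγ hEb

/-- Quadratic growth of the cost at a solution of the Lagrange system, for `γ` large with respect
to the bound `M` of the multipliers. -/
theorem cost_quadratic_growth (hε : 0 < ε) (hγ : 0 < γ) {M : ℝ}
    (hL : SolvesLagrange θbar ε γ p lam)
    (hM : ∀ i, ∀ x ∈ Icc (0 : ℝ) 1, |(lam i).fn x| ≤ M) (hMγ : 32 * M ^ 2 ≤ γ)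
    (hMε : 32 * n * M ^ 2 ≤ ε * γ) (hq : q ∈ admissible n) :
    cost θbar ε γ p + ((1 / 4) * ∑ i, (∫ s in (0 : ℝ)..1, ((q.θ i).fn s - (p.θ i).fn s) ^ 2)
      + ε / 4 * (∫ s in (0 : ℝ)..1, (q.α.wderiv s - p.α.wderiv s) ^ 2)
      + γ / 4 * ∑ i, ‖q.h i - p.h i‖ ^ 2) ≤ cost θbar ε γ q := by
  have hsum := Finset.sum_le_sum fun i (_ : i ∈ Finset.univ) =>
    tracking_lower_bound (q := q) hγ hL hM hMγ hq i
  simp only [Finset.sum_sub_distrib, Finset.sum_add_distrib, ← Finset.mul_sum, Finset.sum_const,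
    Finset.card_univ, Fintype.card_fin, nsmul_eq_mul] at hsum
  have hpoinc : ∫ s in (0 : ℝ)..1, (q.α.fn s - p.α.fn s) ^ 2 ≤
      ∫ s in (0 : ℝ)..1, (q.α.wderiv s - p.α.wderiv s) ^ 2 := by
    have hc : Continuous fun s => (q.α.fn s - p.α.fn s) ^ 2 :=
      (q.α.continuous_fn.sub p.α.continuous_fn).pow 2
    refine (intervalIntegral.integral_mono_on zero_le_one (hc.intervalIntegrable _ _)
      intervalIntegrable_const fun s hs => H10L.sq_sub_le q.α p.α hs).trans ?_
    simp
  -- the design equation tested with the variation of the design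
  have hdes : ε * ((∫ s in (0 : ℝ)..1, p.α.wderiv s * q.α.wderiv s) -
      ∫ s in (0 : ℝ)..1, p.α.wderiv s * p.α.wderiv s) =
      -∑ i, ∫ s in (0 : ℝ)..1, (lam i).fn s * inner ℝ (p.h i) (D2m (p.α.fn s + (p.θ i).fn s)) *
          (q.α.fn s - p.α.fn s) := by
    have cD := continuous_designTerm ε p lam
    have a1 := hL.2.2.1 q.α
    have a2 := hL.2.2.1 p.α
    have a3 : (∫ s in (0 : ℝ)..1, designTerm ε p lam s * q.α.fn s) -
        (∫ s in (0 : ℝ)..1, designTerm ε p lam s * p.α.fn s) =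
        (1 / ε) * ∑ i, ∫ s in (0 : ℝ)..1, (lam i).fn s *
          inner ℝ (p.h i) (D2m (p.α.fn s + (p.θ i).fn s)) * (q.α.fn s - p.α.fn s) := by
      rw [← intervalIntegral.integral_sub ((cD.fun_mul q.α.continuous_fn).intervalIntegrable _ _)
        ((cD.fun_mul p.α.continuous_fn).intervalIntegrable _ _), ← intervalIntegral.integral_finsetSum,
        ← intervalIntegral.integral_const_mul]
      · refine integral_congr_Icc fun s _ => ?_
        rw [designTerm, ← Finset.sum_mul]
        ring
      · intro i _
        exact (((lam i).continuous_fn.mul (continuous_inner_D2m _ p i)).mul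
          (q.α.continuous_fn.sub p.α.continuous_fn)).intervalIntegrable _ _
    have a4 : (∫ s in (0 : ℝ)..1, p.α.wderiv s * q.α.wderiv s) -
      (∫ s in (0 : ℝ)..1, p.α.wderiv s * p.α.wderiv s) = -((1 / ε) * ∑ i, ∫ s in (0 : ℝ)..1,
        (lam i).fn s * inner ℝ (p.h i) (D2m (p.α.fn s + (p.θ i).fn s)) *
        (q.α.fn s - p.α.fn s)) := by linarith
    rw [a4]
    field_simp
  have hα : (∫ s in (0 : ℝ)..1, |q.α.wderiv s| ^ 2) - (∫ s in (0 : ℝ)..1, |p.α.wderiv s| ^ 2) =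
      (∫ s in (0 : ℝ)..1, (q.α.wderiv s - p.α.wderiv s) ^ 2) +
      2 * ((∫ s in (0 : ℝ)..1, p.α.wderiv s * q.α.wderiv s) -
        ∫ s in (0 : ℝ)..1, p.α.wderiv s * p.α.wderiv s) := by
    have i (a b : H10L) := intervalIntegrable_mul_of_memLp a.memLp_wderiv b.memLp_wderiv
    have e : ∀ s, (q.α.wderiv s - p.α.wderiv s) ^ 2 = q.α.wderiv s * q.α.wderiv s -
      2 * (p.α.wderiv s * q.α.wderiv s) + p.α.wderiv s * p.α.wderiv s := fun s => by ring
    simp only [e, sq_abs]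
    rw [intervalIntegral.integral_add ((i _ _).sub ((i _ _).const_mul 2)) (i _ _),
      intervalIntegral.integral_sub (i _ _) ((i _ _).const_mul 2),
      intervalIntegral.integral_const_mul]
    simp only [sq]
    ring
  have hh : ∑ i, ‖q.h i‖ ^ 2 = ∑ i, ‖p.h i‖ ^ 2 + 2 * ∑ i, inner ℝ (q.h i - p.h i) (p.h i) +
      ∑ i, ‖q.h i - p.h i‖ ^ 2 := by
    rw [Finset.mul_sum, ← Finset.sum_add_distrib, ← Finset.sum_add_distrib]
    refine Finset.sum_congr rfl fun i _ => ?_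
    have := norm_add_sq_real (q.h i - p.h i) (p.h i)
    rw [sub_add_cancel] at this
    linarith
  set P := ∫ s in (0 : ℝ)..1, (q.α.fn s - p.α.fn s) ^ 2
  set W := ∫ s in (0 : ℝ)..1, (q.α.wderiv s - p.α.wderiv s) ^ 2
  have hδ : n * (8 * M ^ 2 / γ * P) ≤ ε / 4 * W := by
    have h1 : n * (8 * M ^ 2 / γ) ≤ ε / 4 := by
      rw [← mul_div_assoc, div_le_iff₀ hγ]; linarith
    have h2 : 0 ≤ n * (8 * M ^ 2 / γ) := by positivity
    have h3 : 0 ≤ W := intervalIntegral.integral_nonneg zero_le_one fun s _ => sq_nonneg _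
    calc n * (8 * M ^ 2 / γ * P) = n * (8 * M ^ 2 / γ) * P := by ring
      _ ≤ n * (8 * M ^ 2 / γ) * W := by gcongr
      _ ≤ ε / 4 * W := by gcongr
  have hα' : ε / 2 * (∫ s in (0 : ℝ)..1, |q.α.wderiv s| ^ 2) -
      ε / 2 * (∫ s in (0 : ℝ)..1, |p.α.wderiv s| ^ 2) = ε / 2 * W +
      ε * ((∫ s in (0 : ℝ)..1, p.α.wderiv s * q.α.wderiv s) -
        ∫ s in (0 : ℝ)..1, p.α.wderiv s * p.α.wderiv s) := by
    linear_combination (ε / 2) * hα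
  rw [hdes] at hα'
  rw [cost, cost, hh]
  linarith

theorem eq_zero_of_integral_sq {u : ℝ → ℝ} (hu : Continuous u)
    (h : ∫ s in (0 : ℝ)..1, u s ^ 2 ≤ 0) : ∀ x ∈ Icc (0 : ℝ) 1, u x = 0 := by
  by_contra! hx
  obtain ⟨x, hx, hne⟩ := hx
  have := intervalIntegral.integral_pos zero_lt_one (hu.pow 2).continuousOn
    (fun s _ => sq_nonneg (u s)) ⟨x, hx, sq_pos_of_ne_zero hne⟩
  simp only [Pi.pow_apply] at this
  exact absurd h this.not_ge

/-- A solution of the Lagrange system is a strict global minimizer for `γ` large. -/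
theorem SolvesLagrange.eq_of_cost_le (hε : 0 < ε) (hγ : 0 < γ) {M : ℝ}
    (hL : SolvesLagrange θbar ε γ p lam)
    (hM : ∀ i, ∀ x ∈ Icc (0 : ℝ) 1, |(lam i).fn x| ≤ M) (hMγ : 32 * M ^ 2 ≤ γ)
    (hMε : 32 * n * M ^ 2 ≤ ε * γ) (hq : q ∈ admissible n)
    (hle : cost θbar ε γ q ≤ cost θbar ε γ p) : q = p := by
  have hgr := cost_quadratic_growth hε hγ hL hM hMγ hMε hq
  have n1 : ∀ i, 0 ≤ ∫ s in (0 : ℝ)..1, ((q.θ i).fn s - (p.θ i).fn s) ^ 2 := fun i =>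
    intervalIntegral.integral_nonneg zero_le_one fun s _ => sq_nonneg _
  have n1' := Finset.sum_nonneg fun i (_ : i ∈ Finset.univ) => n1 i
  have n2 : 0 ≤ ε / 4 * ∫ s in (0 : ℝ)..1, (q.α.wderiv s - p.α.wderiv s) ^ 2 :=
    mul_nonneg (by positivity) (intervalIntegral.integral_nonneg zero_le_one fun s _ => sq_nonneg _)
  have n3 : 0 ≤ γ / 4 * ∑ i, ‖q.h i - p.h i‖ ^ 2 := by positivity
  have z1 : ∑ i, (∫ s in (0 : ℝ)..1, ((q.θ i).fn s - (p.θ i).fn s) ^ 2) = 0 := by linarith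
  have z2 : ∫ s in (0 : ℝ)..1, (q.α.wderiv s - p.α.wderiv s) ^ 2 ≤ 0 :=
    nonpos_of_mul_nonpos_right (by linarith) (by positivity : (0 : ℝ) < ε / 4)
  have z3 : ∑ i, ‖q.h i - p.h i‖ ^ 2 = 0 :=
    le_antisymm (nonpos_of_mul_nonpos_right (by linarith) (by positivity : (0 : ℝ) < γ / 4))
      (by positivity)
  refine Config.ext (funext fun i => ?_) (H10L.ext_fn fun x hx => ?_) (funext fun i =>
    H10L.ext_fn fun x hx => ?_)
  · have := (Finset.sum_eq_zero_iff_of_nonneg fun i _ => sq_nonneg _).1 z3 i (Finset.mem_univ i)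
    exact sub_eq_zero.1 (norm_eq_zero.1 (pow_eq_zero_iff two_ne_zero |>.1 this))
  · have := (H10L.sq_sub_le q.α p.α hx).trans z2
    exact sub_eq_zero.1 (pow_eq_zero_iff two_ne_zero |>.1 (le_antisymm this (sq_nonneg _)))
  · have := (Finset.sum_eq_zero_iff_of_nonneg fun i _ => n1 i).1 z1 i (Finset.mem_univ i)
    exact sub_eq_zero.1 (eq_zero_of_integral_sq
      ((q.θ i).continuous_fn.sub (p.θ i).continuous_fn) this.le x hx)

theorem SolvesLagrange.isMinimizer (hε : 0 < ε) (hγ : 0 < γ) {M : ℝ}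
    (hL : SolvesLagrange θbar ε γ p lam)
    (hM : ∀ i, ∀ x ∈ Icc (0 : ℝ) 1, |(lam i).fn x| ≤ M) (hMγ : 32 * M ^ 2 ≤ γ)
    (hMε : 32 * n * M ^ 2 ≤ ε * γ) : IsMinimizer θbar ε γ p := by
  refine ⟨hL.1, fun q hq => le_of_not_gt fun h => ?_⟩
  rw [hL.eq_of_cost_le hε hγ hM hMγ hMε hq h.le] at h
  exact lt_irrefl _ h

end Lagrange

end MagneticBeam

namespace MagneticBeam

/-! ### Existence for the Lagrange system by contraction -/

section Existence

variable {n : ℕ}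

/-- The Green operator on `C([0,1])`. -/
noncomputable def greenC (f : C(unitInterval, ℝ)) : C(unitInterval, ℝ) :=
  ⟨fun x => green (ext f) x, (continuous_green (continuous_ext f)).comp continuous_subtype_val⟩

theorem norm_greenC_le {f : C(unitInterval, ℝ)} {c : ℝ} (hc : 0 ≤ c) (h : ∀ x, |f x| ≤ c) :
    ‖greenC f‖ ≤ c / 2 := by
  refine (ContinuousMap.norm_le _ (by positivity)).2 fun x => ?_
  exact abs_green_le_half (continuous_ext f) (fun s hs => by rw [ext_of_mem _ hs]; exact h _) x.2

theorem dist_greenC_le {f g : C(unitInterval, ℝ)} {c : ℝ} (hc : 0 ≤ c)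
    (h : ∀ x, |f x - g x| ≤ c) : dist (greenC f) (greenC g) ≤ c / 2 := by
  refine (ContinuousMap.dist_le (by positivity)).2 fun x => ?_
  rw [Real.dist_eq]
  change |green (ext f) x - green (ext g) x| ≤ c / 2
  rw [← green_sub (continuous_ext f) (continuous_ext g)]
  refine abs_green_le_half ((continuous_ext f).fun_sub (continuous_ext g)) (fun s hs => ?_) x.2
  rw [ext_of_mem _ hs, ext_of_mem _ hs]
  exact h _

/-- The right-hand side `h · Dm(α + θ)` of the state equation. -/
noncomputable def stateSource (h : Plane) (a t : C(unitInterval, ℝ)) : C(unitInterval, ℝ) :=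
  ⟨fun x => inner ℝ h (Dm (a x + t x)),
    continuous_const.inner (continuous_Dm.comp (a.continuous.add t.continuous))⟩

/-- The term `λ h · D²m(α + θ)` that couples the adjoint and the design equations. -/
noncomputable def couplingSource (h : Plane) (a t l : C(unitInterval, ℝ)) : C(unitInterval, ℝ) :=
  ⟨fun x => l x * inner ℝ h (D2m (a x + t x)),
    l.continuous.mul
      (continuous_const.inner (continuous_D2m.comp (a.continuous.add t.continuous)))⟩

theorem abs_inner_Dm_sub_le (h h' : Plane) (v v' : ℝ) :
    |inner ℝ h (Dm v) - inner ℝ h' (Dm v')| ≤ ‖h - h'‖ + ‖h'‖ * |v - v'| := by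
  have e : (inner ℝ h (Dm v) : ℝ) - inner ℝ h' (Dm v') =
      inner ℝ (h - h') (Dm v) + inner ℝ h' (Dm v - Dm v') := by
    rw [inner_sub_left, inner_sub_right]; ring
  rw [e]
  refine (abs_add_le _ _).trans (add_le_add (abs_inner_Dm_le _ _) ?_)
  exact (abs_real_inner_le_norm _ _).trans (by gcongr; exact norm_Dm_sub_le v v')

theorem abs_coupling_sub_le (h h' : Plane) (v v' l l' : ℝ) :
    |l * inner ℝ h (D2m v) - l' * inner ℝ h' (D2m v')| ≤
      |l - l'| * ‖h‖ + |l'| * (‖h - h'‖ + ‖h'‖ * |v - v'|) := by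
  have e : l * inner ℝ h (D2m v) - l' * inner ℝ h' (D2m v') =
      (l - l') * inner ℝ h (D2m v) + l' * (inner ℝ h (D2m v) - inner ℝ h' (D2m v')) := by ring
  rw [e]
  refine (abs_add_le _ _).trans ?_
  rw [abs_mul, abs_mul]
  gcongr
  · exact abs_inner_D2m_le _ _
  · rw [D2m_eq, D2m_eq]
    refine (abs_inner_Dm_sub_le _ _ _ _).trans (le_of_eq ?_)
    congr 3
    ring

theorem norm_smul_Dm_sub_le (v v' l l' : ℝ) :
    ‖l • Dm v - l' • Dm v'‖ ≤ |l - l'| + |l'| * |v - v'| := by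
  have e : l • Dm v - l' • Dm v' = (l - l') • Dm v + l' • (Dm v - Dm v') := by
    rw [sub_smul, smul_sub]; abel
  rw [e]
  refine (norm_add_le _ _).trans ?_
  rw [norm_smul, norm_smul, norm_Dm, mul_one, Real.norm_eq_abs, Real.norm_eq_abs]
  gcongr
  exact norm_Dm_sub_le v v'

/-- The integral `∫ λ Dm(α + θ)` of the optimality condition for a field. -/
noncomputable def fieldIntegral (a t l : C(unitInterval, ℝ)) : Plane :=
  ∫ s in (0 : ℝ)..1, ext l s • Dm (ext a s + ext t s)

theorem continuous_fieldIntegrand (a t l : C(unitInterval, ℝ)) :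
    Continuous fun s => ext l s • Dm (ext a s + ext t s) :=
  (continuous_ext l).smul (continuous_Dm.comp ((continuous_ext a).add (continuous_ext t)))

theorem norm_fieldIntegral_le {a t l : C(unitInterval, ℝ)} {M : ℝ} (hl : ‖l‖ ≤ M) :
    ‖fieldIntegral a t l‖ ≤ M := by
  refine (intervalIntegral.norm_integral_le_of_norm_le_const (C := M) fun x _ => ?_).trans
    (by simp)
  rw [norm_smul, norm_Dm, mul_one]
  exact (abs_ext_le l x).trans hl

theorem abs_ext_sub_le (v w : C(unitInterval, ℝ)) (x : ℝ) : |ext v x - ext w x| ≤ dist v w := by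
  rw [← Real.dist_eq]; exact ContinuousMap.dist_apply_le_dist _

theorem dist_fieldIntegral_le {a t l a' t' l' : C(unitInterval, ℝ)} {M D : ℝ} (hl : ‖l'‖ ≤ M)
    (ha : dist a a' ≤ D) (ht : dist t t' ≤ D) (hl' : dist l l' ≤ D) :
    ‖fieldIntegral a t l - fieldIntegral a' t' l'‖ ≤ (1 + 2 * M) * D := by
  rw [fieldIntegral, fieldIntegral, ← intervalIntegral.integral_sub
    ((continuous_fieldIntegrand a t l).intervalIntegrable _ _)
    ((continuous_fieldIntegrand a' t' l').intervalIntegrable _ _)]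
  refine (intervalIntegral.norm_integral_le_of_norm_le_const (C := (1 + 2 * M) * D)
    fun x _ => ?_).trans (by simp)
  refine (norm_smul_Dm_sub_le _ _ _ _).trans ?_
  have h1 := (abs_ext_sub_le l l' x).trans hl'
  have h2 : |ext a x + ext t x - (ext a' x + ext t' x)| ≤ 2 * D := by
    rw [add_sub_add_comm]
    exact (abs_add_le _ _).trans (by
      linarith [(abs_ext_sub_le a a' x).trans ha, (abs_ext_sub_le t t' x).trans ht])
  have h3 := mul_le_mul ((abs_ext_le l' x).trans hl) h2 (abs_nonneg _)
    ((norm_nonneg _).trans hl)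
  linarith

/-- Fields, design, states and multipliers, as continuous functions. -/
abbrev FixedPointSpace (n : ℕ) : Type :=
  (Fin n → Plane) × C(unitInterval, ℝ) × (Fin n → C(unitInterval, ℝ)) ×
    (Fin n → C(unitInterval, ℝ))

/-- The fixed-point map of the Lagrange system, the fields being rescaled to `h = r u`: every
equation is solved for its principal unknown. -/
noncomputable def lagrangeMap (θbar : Fin n → C(unitInterval, ℝ)) (ε γ r : ℝ)
    (x : FixedPointSpace n) : FixedPointSpace n :=
  (fun i => -((γ * r)⁻¹ • fieldIntegral x.2.1 (x.2.2.1 i) (x.2.2.2 i)),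
   greenC (-((1 / ε) • ∑ i, couplingSource (r • x.1 i) x.2.1 (x.2.2.1 i) (x.2.2.2 i))),
   fun i => greenC (stateSource (r • x.1 i) x.2.1 (x.2.2.1 i)),
   fun i => greenC (couplingSource (r • x.1 i) x.2.1 (x.2.2.1 i) (x.2.2.2 i) +
    (x.2.2.1 i - θbar i)))

/-- The closed set on which the fixed-point map is a contraction. -/
def invariantSet (n : ℕ) (M : ℝ) : Set (FixedPointSpace n) :=
  {x | (∀ i, ‖x.1 i‖ ≤ 1) ∧ (∀ i, ‖x.2.2.1 i‖ ≤ 1) ∧ ∀ i, ‖x.2.2.2 i‖ ≤ M}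

theorem isClosed_invariantSet (n : ℕ) (M : ℝ) : IsClosed (invariantSet n M) := by
  refine IsClosed.and ?_ (IsClosed.and ?_ ?_) <;>
  · simp only [ofPred_forall]
    exact isClosed_iInter fun i => isClosed_le (by fun_prop) continuous_const

variable {θbar : Fin n → C(unitInterval, ℝ)} {ε γ r M : ℝ}

theorem norm_field_le {u : Plane} (hr : 0 < r) (hu : ‖u‖ ≤ 1) : ‖r • u‖ ≤ r := by
  rw [norm_smul, Real.norm_of_nonneg hr.le]
  exact mul_le_of_le_one_right hr.le hu

theorem mapsTo_lagrangeMap (hr : 0 < r) (hr1 : r ≤ 1) (hγ : 0 < γ)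
    (hM : 1 + ‖θbar‖ ≤ M) (hγr : M ≤ γ * r) :
    MapsTo (lagrangeMap θbar ε γ r) (invariantSet n M) (invariantSet n M) := by
  rintro ⟨u, a, t, l⟩ ⟨hu, ht, hl⟩
  have hM0 : 0 ≤ M := le_trans (by positivity) hM
  refine ⟨fun i => ?_, fun i => ?_, fun i => ?_⟩
  · simp only [lagrangeMap, norm_neg, norm_smul]
    rw [Real.norm_of_nonneg (by positivity), inv_mul_le_iff₀ (by positivity), mul_one]
    exact (norm_fieldIntegral_le (hl i)).trans hγr
  · refine (norm_greenC_le (c := r) hr.le fun x => ?_).trans (by linarith)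
    exact (abs_inner_Dm_le _ _).trans (norm_field_le hr (hu i))
  · refine (norm_greenC_le (c := M * r + M) (by positivity) fun x => ?_).trans (by nlinarith)
    have h1 : |t i x| ≤ 1 := ((t i).norm_coe_le_norm x).trans (ht i)
    have h2 : |θbar i x| ≤ ‖θbar‖ :=
      ((θbar i).norm_coe_le_norm x).trans (norm_le_pi_norm θbar i)
    refine (abs_add_le _ _).trans (add_le_add ?_ ((abs_sub _ _).trans (by linarith)))
    change |l i x * inner ℝ (r • u i) (D2m (a x + t i x))| ≤ M * r
    rw [abs_mul]
    exact mul_le_mul (((l i).norm_coe_le_norm x).trans (hl i))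
      ((abs_inner_D2m_le _ _).trans (norm_field_le hr (hu i))) (abs_nonneg _) hM0

/-- On the invariant set all the couplings are of order `r` or `(γ r)⁻¹`, except the one of the
states with the multipliers; its Lipschitz constant `1 / 2` comes from the Green operator. -/
theorem dist_lagrangeMap_le (hε : 0 < ε) (hγ : 0 < γ) (hr : 0 < r) (hM : 1 ≤ M)
    (hr2 : r * (1 + 3 * M) ≤ 1 / 2) (hrε : n * (r * (1 + 3 * M)) ≤ ε)
    (hγr : 2 * (1 + 3 * M) ≤ γ * r) {x y : FixedPointSpace n} (hx : x ∈ invariantSet n M)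
    (hy : y ∈ invariantSet n M) :
    dist (lagrangeMap θbar ε γ r x) (lagrangeMap θbar ε γ r y) ≤ 3 / 4 * dist x y := by
  obtain ⟨u, a, t, l⟩ := x
  obtain ⟨u', a', t', l'⟩ := y
  obtain ⟨hu, ht, hl⟩ := hx
  obtain ⟨hu', ht', hl'⟩ := hy
  simp only at hu ht hl hu' ht' hl'
  set D := dist (u, a, t, l) (u', a', t', l') with hD
  have hD0 : 0 ≤ D := dist_nonneg
  have hD1 : dist u u' ≤ D := le_max_left _ _
  have hD2 : dist a a' ≤ D := (le_max_left _ _).trans (le_max_right _ _)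
  have hD3 : dist t t' ≤ D :=
    (le_max_left _ _).trans ((le_max_right _ _).trans (le_max_right _ _))
  have hD4 : dist l l' ≤ D :=
    (le_max_right _ _).trans ((le_max_right _ _).trans (le_max_right _ _))
  have du (i) : ‖r • u i - r • u' i‖ ≤ r * D := by
    rw [← smul_sub, norm_smul, Real.norm_of_nonneg hr.le, ← dist_eq_norm]
    gcongr
    exact (dist_le_pi_dist u u' i).trans hD1
  have dt (i) : dist (t i) (t' i) ≤ D := (dist_le_pi_dist t t' i).trans hD3
  have dl (i) : dist (l i) (l' i) ≤ D := (dist_le_pi_dist l l' i).trans hD4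
  have ptw (v w : C(unitInterval, ℝ)) (x) : |v x - w x| ≤ dist v w := by
    rw [← Real.dist_eq]; exact ContinuousMap.dist_apply_le_dist _
  have dang (i x) : |a x + t i x - (a' x + t' i x)| ≤ 2 * D := by
    rw [add_sub_add_comm]
    exact (abs_add_le _ _).trans (by linarith [(ptw a a' x).trans hD2, (ptw _ _ x).trans (dt i)])
  have dstate (i x) : |stateSource (r • u i) a (t i) x - stateSource (r • u' i) a' (t' i) x| ≤
      3 * r * D := by
    refine (abs_inner_Dm_sub_le _ _ _ _).trans ?_
    have := mul_le_mul (norm_field_le hr (hu' i)) (dang i x) (abs_nonneg _) hr.le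
    linarith [du i]
  have dcoup (i x) : |couplingSource (r • u i) a (t i) (l i) x -
      couplingSource (r • u' i) a' (t' i) (l' i) x| ≤ r * (1 + 3 * M) * D := by
    refine (abs_coupling_sub_le _ _ _ _ _ _).trans ?_
    have h1 := mul_le_mul (norm_field_le hr (hu' i)) (dang i x) (abs_nonneg _) hr.le
    have h2 := mul_le_mul ((ptw _ _ x).trans (dl i)) (norm_field_le hr (hu i)) (norm_nonneg _) hD0
    have h3 := mul_le_mul (((l' i).norm_coe_le_norm x).trans (hl' i)) (add_le_add (du i) h1)
      (by positivity) (by linarith)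
    rw [Real.norm_eq_abs] at h3
    linarith
  refine max_le ?_ (max_le ?_ (max_le ?_ ?_))
  · refine (dist_pi_le_iff (by positivity)).2 fun i => ?_
    simp only [lagrangeMap]
    rw [dist_neg_neg, dist_eq_norm, ← smul_sub, norm_smul, Real.norm_of_nonneg (by positivity),
      inv_mul_le_iff₀ (by positivity)]
    refine (dist_fieldIntegral_le (hl' i) hD2 (dt i) (dl i)).trans ?_
    nlinarith
  · refine (dist_greenC_le (c := ε⁻¹ * (n * (r * (1 + 3 * M) * D))) (by positivity)
      fun x => ?_).trans ?_
    · simp only [ContinuousMap.neg_apply, ContinuousMap.smul_apply, ContinuousMap.sum_apply,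
        smul_eq_mul, one_div]
      rw [neg_sub_neg, ← mul_sub, ← Finset.sum_sub_distrib, abs_mul, abs_of_nonneg (by positivity)]
      gcongr
      refine (Finset.abs_sum_le_sum_abs _ _).trans ((Finset.sum_le_card_nsmul _ _ _ fun i _ => ?_
        ).trans (by rw [Finset.card_univ, Fintype.card_fin, nsmul_eq_mul]))
      rw [abs_sub_comm]
      exact dcoup i x
    · have : ε⁻¹ * (n * (r * (1 + 3 * M) * D)) ≤ D := by
        rw [inv_mul_le_iff₀ hε]
        nlinarith
      linarith
  · refine (dist_pi_le_iff (by positivity)).2 fun i => ?_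
    refine (dist_greenC_le (by positivity) (dstate i)).trans ?_
    nlinarith
  · refine (dist_pi_le_iff (by positivity)).2 fun i => ?_
    refine (dist_greenC_le (c := r * (1 + 3 * M) * D + D) (by positivity) fun x => ?_).trans ?_
    · simp only [ContinuousMap.add_apply, ContinuousMap.sub_apply]
      rw [add_sub_add_comm, sub_sub_sub_cancel_right]
      exact (abs_add_le _ _).trans (add_le_add (dcoup i x) ((ptw _ _ x).trans (dt i)))
    · nlinarith

/-- Fixed points are solutions of the Lagrange system. -/
theorem exists_solvesLagrange_of_fixed {h : Fin n → Plane} {a : C(unitInterval, ℝ)}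
    {t l : Fin n → C(unitInterval, ℝ)}
    (ha : greenC (-((1 / ε) • ∑ i, couplingSource (h i) a (t i) (l i))) = a)
    (ht : ∀ i, greenC (stateSource (h i) a (t i)) = t i)
    (hl : ∀ i, greenC (couplingSource (h i) a (t i) (l i) + (t i - θbar i)) = l i)
    (hh : ∀ i, γ • h i = -fieldIntegral a (t i) (l i)) :
    ∃ (p : Config n) (lam : Fin n → H10L), SolvesLagrange θbar ε γ p lam ∧ p.h = h := by
  let p : Config n :=
    { h := h
      α := greenH _ (continuous_ext (-((1 / ε) • ∑ i, couplingSource (h i) a (t i) (l i))))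
      θ := fun i => greenH _ (continuous_ext (stateSource (h i) a (t i))) }
  let lam : Fin n → H10L := fun i =>
    greenH _ (continuous_ext (couplingSource (h i) a (t i) (l i) + (t i - θbar i)))
  have eα : p.α.fn = ext a := congrArg ext ha
  have eθ (i) : (p.θ i).fn = ext (t i) := congrArg ext (ht i)
  have el (i) : (lam i).fn = ext (l i) := congrArg ext (hl i)
  refine ⟨p, lam, ⟨fun i => ?_, fun i => ?_, ?_, fun i => ?_⟩, rfl⟩
  · refine weakSol_of_eq_green (continuous_stateTerm p i) fun x hx => ?_
    refine (greenH_fn (continuous_ext _) hx).trans (green_congr (fun s hs => ?_) hx)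
    rw [stateTerm, eα, eθ, ext_of_mem _ hs, ext_of_mem _ hs, ext_of_mem _ hs, neg_neg]
    rfl
  · refine weakSol_of_eq_green (continuous_adjointTerm θbar p lam i) fun x hx => ?_
    refine (greenH_fn (continuous_ext _) hx).trans (green_congr (fun s hs => ?_) hx)
    rw [adjointTerm, eα, eθ, el, ext_of_mem _ hs, ext_of_mem _ hs, ext_of_mem _ hs,
      ext_of_mem _ hs, ext_of_mem _ hs, neg_sub, sub_neg_eq_add, add_comm]
    rfl
  · refine weakSol_of_eq_green (continuous_designTerm ε p lam) fun x hx => ?_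
    refine (greenH_fn (continuous_ext _) hx).trans (green_congr (fun s hs => ?_) hx)
    simp only [designTerm, eα, eθ, el, ext_of_mem _ hs, ContinuousMap.neg_apply,
      ContinuousMap.smul_apply, ContinuousMap.sum_apply, smul_eq_mul]
    rfl
  · rw [eα, eθ, el]
    exact hh i

theorem exists_solvesLagrange (θbar : Fin n → C(unitInterval, ℝ)) (hε : 0 < ε) {K : ℝ}
    (hK : 0 < K) :
    ∃ γ₀, ∀ γ, γ₀ < γ → ∃ (p : Config n) (lam : Fin n → H10L),
      SolvesLagrange θbar ε γ p lam ∧ ∀ i, ‖p.h i‖ ≤ K := by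
  set M := 1 + ‖θbar‖ with hM
  have hM1 : 1 ≤ M := by rw [hM]; linarith [norm_nonneg θbar]
  set A := 1 + 3 * M with hA
  have hA0 : 0 < A := by positivity
  obtain ⟨r, hr0, hr1, hrK, hr2, hrε⟩ : ∃ r : ℝ, 0 < r ∧ r ≤ 1 ∧ r ≤ K ∧ r * A ≤ 1 / 2 ∧
      n * (r * A) ≤ ε := by
    refine ⟨min (min 1 K) (min (1 / 2 / A) (ε / ((n + 1) * A))), by positivity,
      (min_le_left _ _).trans (min_le_left _ _), (min_le_left _ _).trans (min_le_right _ _), ?_, ?_⟩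
    · exact (le_div_iff₀ hA0).1 ((min_le_right _ _).trans (min_le_left _ _))
    · set r := min (min 1 K) (min (1 / 2 / A) (ε / ((n + 1) * A))) with hr
      have h1 : r * ((n + 1) * A) ≤ ε :=
        (le_div_iff₀ (by positivity)).1 ((min_le_right _ _).trans (min_le_right _ _))
      have h2 : 0 < r := by positivity
      nlinarith [mul_pos h2 hA0]
  refine ⟨2 * A / r, fun γ hγ => ?_⟩
  have hγ0 : 0 < γ := lt_of_le_of_lt (by positivity) hγ
  have hγr : 2 * A ≤ γ * r := ((div_lt_iff₀ hr0).1 hγ).le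
  have hmaps := mapsTo_lagrangeMap (ε := ε) hr0 hr1 hγ0 hM.ge (by linarith : M ≤ γ * r)
  have hcontr : ContractingWith (3 / 4) (hmaps.restrict _ _ _) := by
    refine ⟨?_, LipschitzWith.of_dist_le_mul fun x y => ?_⟩
    · rw [div_lt_one (by norm_num)]; norm_num
    · exact dist_lagrangeMap_le hε hγ0 hr0 hM1 hr2 hrε hγr x.2 y.2
  obtain ⟨⟨u, a, t, l⟩, hmem, hfix, -⟩ := hcontr.exists_fixedPoint'
    (isClosed_invariantSet n M).isComplete hmaps (x := 0)
    ⟨fun i => by simp, fun i => by simp, fun i => by simpa using zero_le_one.trans hM1⟩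
    (edist_ne_top _ _)
  have f1 : (lagrangeMap θbar ε γ r (u, a, t, l)).1 = u := congrArg Prod.fst hfix
  have f2 : (lagrangeMap θbar ε γ r (u, a, t, l)).2.1 = a :=
    congrArg (fun x => x.2.1) hfix
  have f3 : (lagrangeMap θbar ε γ r (u, a, t, l)).2.2.1 = t :=
    congrArg (fun x => x.2.2.1) hfix
  have f4 : (lagrangeMap θbar ε γ r (u, a, t, l)).2.2.2 = l :=
    congrArg (fun x => x.2.2.2) hfix
  obtain ⟨p, lam, hp, hh⟩ := exists_solvesLagrange_of_fixed (θbar := θbar) (ε := ε) (γ := γ)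
    (h := fun i => r • u i) f2 (fun i => congrFun f3 i) (fun i => congrFun f4 i) fun i => by
      have := congrFun f1 i
      simp only [lagrangeMap] at this
      rw [← this, smul_neg, smul_neg, smul_smul, smul_smul, mul_inv_cancel₀ (by positivity),
        one_smul]
  refine ⟨p, lam, hp, fun i => ?_⟩
  rw [hh]
  exact (norm_field_le hr0 (hmem.1 i)).trans hrK

end Existence

/-! ### Smoothness and the boundary condition of the design -/

section Smoothness

variable {n : ℕ} {θbar : Fin n → C(unitInterval, ℝ)} {ε γ : ℝ} {p : Config n}
  {lam : Fin n → H10L}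

theorem contDiffOn_inner_Dm {g : ℝ → ℝ} {s : Set ℝ} {m : ℕ} (hg : ContDiffOn ℝ m g s)
    (h : Plane) : ContDiffOn ℝ m (fun x => (inner ℝ h (Dm (g x)) : ℝ)) s := by
  simp only [inner_Dm]
  exact (contDiffOn_const.mul hg.sin).add (contDiffOn_const.mul hg.cos)

theorem contDiffOn_inner_D2m {g : ℝ → ℝ} {s : Set ℝ} {m : ℕ} (hg : ContDiffOn ℝ m g s)
    (h : Plane) : ContDiffOn ℝ m (fun x => (inner ℝ h (D2m (g x)) : ℝ)) s := by
  simp only [D2m_eq]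
  exact contDiffOn_inner_Dm (hg.add contDiffOn_const) h

theorem SolvesLagrange.classically (hL : SolvesLagrange θbar ε γ p lam) :
    SolvesLagrangeClassically θbar ε γ p lam :=
  ⟨fun i => (hL.1 i).classicalSol (continuous_stateTerm p i),
    fun i => (hL.2.1 i).classicalSol (continuous_adjointTerm θbar p lam i),
    hL.2.2.1.classicalSol (continuous_designTerm ε p lam), hL.2.2.2⟩

theorem SolvesLagrange.contDiffOn_state (hL : SolvesLagrange θbar ε γ p lam) {m : ℕ}
    (hα : ContDiffOn ℝ m p.α.fn (Icc 0 1)) {i : Fin n}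
    (hθ : ContDiffOn ℝ m (p.θ i).fn (Icc 0 1)) :
    ContDiffOn ℝ ((m + 2 : ℕ) : WithTop ℕ∞) (p.θ i).fn (Icc 0 1) :=
  (hL.1 i).contDiffOn (continuous_stateTerm p i) (contDiffOn_inner_Dm (hα.add hθ) _).neg

theorem SolvesLagrange.contDiffOn_design (hL : SolvesLagrange θbar ε γ p lam) {m : ℕ}
    (hα : ContDiffOn ℝ m p.α.fn (Icc 0 1)) (hθ : ∀ i, ContDiffOn ℝ m (p.θ i).fn (Icc 0 1))
    (hl : ∀ i, ContDiffOn ℝ m (lam i).fn (Icc 0 1)) :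
    ContDiffOn ℝ ((m + 2 : ℕ) : WithTop ℕ∞) p.α.fn (Icc 0 1) :=
  hL.2.2.1.contDiffOn (continuous_designTerm ε p lam) (contDiffOn_const.mul
    (ContDiffOn.sum fun i _ => (hl i).mul (contDiffOn_inner_D2m (hα.add (hθ i)) _)))

theorem SolvesLagrange.contDiffOn_multiplier (hL : SolvesLagrange θbar ε γ p lam) {m : ℕ}
    (hα : ContDiffOn ℝ m p.α.fn (Icc 0 1)) {i : Fin n}
    (hθ : ContDiffOn ℝ m (p.θ i).fn (Icc 0 1)) (hl : ContDiffOn ℝ m (lam i).fn (Icc 0 1))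
    (hb : ContDiffOn ℝ m (ext (θbar i)) (Icc 0 1)) :
    ContDiffOn ℝ ((m + 2 : ℕ) : WithTop ℕ∞) (lam i).fn (Icc 0 1) :=
  (hL.2.1 i).contDiffOn (continuous_adjointTerm θbar p lam i)
    ((hl.mul (contDiffOn_inner_D2m (hα.add hθ) _)).neg.sub (hθ.sub hb))

/-- Bootstrap: the multipliers gain two derivatives with respect to the targets, the design two
more, and the states again two. -/
theorem SolvesLagrange.contDiffOn (hL : SolvesLagrange θbar ε γ p lam) {k : ℕ}
    (hb : ∀ i, ContDiffOn ℝ k (ext (θbar i)) (Icc 0 1)) :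
    ContDiffOn ℝ (k + 4) p.α.fn (Icc 0 1) ∧
      ∀ i, ContDiffOn ℝ (k + 6) (p.θ i).fn (Icc 0 1) ∧
        ContDiffOn ℝ (k + 2) (lam i).fn (Icc 0 1) := by
  have key : ∀ m : ℕ, m ≤ k + 2 → ContDiffOn ℝ m p.α.fn (Icc 0 1) ∧
      (∀ i, ContDiffOn ℝ m (p.θ i).fn (Icc 0 1)) ∧
      ∀ i, ContDiffOn ℝ m (lam i).fn (Icc 0 1) := by
    intro m
    induction m with
    | zero =>
      intro _
      simp only [Nat.cast_zero, contDiffOn_zero]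
      exact ⟨p.α.continuous_fn.continuousOn, fun i => (p.θ i).continuous_fn.continuousOn,
        fun i => (lam i).continuous_fn.continuousOn⟩
    | succ m ih =>
      intro hm
      obtain ⟨h1, h2, h3⟩ := ih (by omega)
      have hj : ((min m k : ℕ) : WithTop ℕ∞) ≤ m := by exact_mod_cast min_le_left m k
      have hj' : ((min m k : ℕ) : WithTop ℕ∞) ≤ k := by exact_mod_cast min_le_right m k
      have hm' : ((m + 1 : ℕ) : WithTop ℕ∞) ≤ ((min m k + 2 : ℕ) : WithTop ℕ∞) := by
        exact_mod_cast (by omega : m + 1 ≤ min m k + 2)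
      refine ⟨(hL.contDiffOn_design (h1.of_le hj) (fun i => (h2 i).of_le hj)
        fun i => (h3 i).of_le hj).of_le hm',
        fun i => (hL.contDiffOn_state (h1.of_le hj) ((h2 i).of_le hj)).of_le hm',
        fun i => (hL.contDiffOn_multiplier (h1.of_le hj) ((h2 i).of_le hj) ((h3 i).of_le hj)
          ((hb i).of_le hj')).of_le hm'⟩
  obtain ⟨h1, h2, h3⟩ := key (k + 2) le_rfl
  have h4 := hL.contDiffOn_design h1 h2 h3
  have h5 := fun i => hL.contDiffOn_state h1 (h2 i)
  have h6 := fun i => hL.contDiffOn_state h4 (h5 i)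
  exact ⟨by exact_mod_cast h4, fun i => ⟨by exact_mod_cast h6 i, by exact_mod_cast h3 i⟩⟩

/-- Since `h · D²m = h^⊥ · Dm` with `h^⊥ ⟂ h`, the optimality condition for the fields makes the
source of the design equation have zero mean. -/
theorem SolvesLagrange.hasDerivWithinAt_design_zero (hL : SolvesLagrange θbar ε γ p lam) :
    HasDerivWithinAt p.α.fn 0 (Icc 0 1) 0 := by
  have h := hL.2.2.1.hasDerivWithinAt (continuous_designTerm ε p lam) (left_mem_Icc.2 zero_le_one)
  have hz (i) : ∫ s in (0 : ℝ)..1, (lam i).fn s *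
      inner ℝ (p.h i) (D2m (p.α.fn s + (p.θ i).fn s)) = 0 := by
    have h1 := hL.2.2.2.inner_eq !₂[p.h i 1, -p.h i 0] i
    have h2 : inner ℝ !₂[p.h i 1, -p.h i 0] (p.h i) = (0 : ℝ) := by
      simp [PiLp.inner_apply, Fin.sum_univ_two]
      ring
    have h3 : ∀ v : ℝ, (inner ℝ !₂[p.h i 1, -p.h i 0] (Dm v) : ℝ) = inner ℝ (p.h i) (D2m v) := by
      intro v
      rw [D2m_eq, inner_Dm, inner_Dm, Real.sin_add_pi_div_two, Real.cos_add_pi_div_two]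
      simp
      ring
    simp only [h2, h3, mul_zero] at h1
    linarith
  have h0 : ∫ s in (0 : ℝ)..1, -designTerm ε p lam s = 0 := by
    simp only [designTerm]
    rw [intervalIntegral.integral_neg, intervalIntegral.integral_const_mul,
      intervalIntegral.integral_finsetSum fun i _ => ((lam i).continuous_fn.fun_mul
        (continuous_inner_D2m _ p i)).intervalIntegrable _ _]
    simp [hz]
  rwa [h0] at h

end Smoothness

end MagneticBeam

open MagneticBeam
theorem theorem1p4 (n : ℕ) (θbar : Fin n → C(unitInterval, ℝ)) (ε K : ℝ)
    (hε : 0 < ε) (hK : 0 < K) (hKcp : K < (cp ^ 2)⁻¹) :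
    ∃ γss : ℝ, ∀ γ : ℝ, γss < γ →
      ∃ (p : Config n) (lam : Fin n → H10L),
        -- `p` is the unique minimizer
        (IsMinimizer θbar ε γ p ∧ ∀ q : Config n, IsMinimizer θbar ε γ q → q = p) ∧
        -- `(p, lam)` is the unique solution of the Lagrange system with fields bounded by `K`
        (SolvesLagrange θbar ε γ p lam ∧ (∀ i, ‖p.h i‖ ≤ K) ∧
          ∀ (q : Config n) (mu : Fin n → H10L),
            SolvesLagrange θbar ε γ q mu → (∀ i, ‖q.h i‖ ≤ K) → q = p ∧ mu = lam) ∧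
        -- smoothness
        SolvesLagrangeClassically θbar ε γ p lam ∧
        (∀ k : ℕ, (∀ i, ContDiffOn ℝ k (ext (θbar i)) (Set.Icc 0 1)) →
          ContDiffOn ℝ (k + 4) p.α.fn (Set.Icc 0 1) ∧
          ∀ i, ContDiffOn ℝ (k + 6) (p.θ i).fn (Set.Icc 0 1) ∧
            ContDiffOn ℝ (k + 2) (lam i).fn (Set.Icc 0 1)) ∧
        -- `α'(0) = 0`
        HasDerivWithinAt p.α.fn 0 (Set.Icc 0 1) 0 ∧
        -- the bound on the states
        ∀ i, ‖(p.θ i).toC‖ ≤ ‖p.h i‖ := by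
  obtain ⟨M, hM0, hM⟩ := exists_multiplier_bound θbar hK hKcp
  obtain ⟨γ₀, hγ₀⟩ := exists_solvesLagrange θbar hε hK
  refine ⟨max γ₀ (max (32 * M ^ 2) (32 * n * M ^ 2 / ε)), fun γ hγ => ?_⟩
  have h1 : 32 * M ^ 2 ≤ γ := ((le_max_left _ _).trans (le_max_right _ _)).trans hγ.le
  have h2 : 32 * n * M ^ 2 ≤ ε * γ :=
    (div_le_iff₀' hε).1 (((le_max_right _ _).trans (le_max_right _ _)).trans hγ.le)
  have hγ0 : 0 < γ := lt_of_lt_of_le (by positivity) h1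
  obtain ⟨p, lam, hL, hp⟩ := hγ₀ γ ((le_max_left _ _).trans_lt hγ)
  have hmin := hL.isMinimizer hε hγ0 (hM ε γ p lam hL hp) h1 h2
  have huniq : ∀ q : Config n, IsMinimizer θbar ε γ q → q = p := fun q hq =>
    hL.eq_of_cost_le hε hγ0 (hM ε γ p lam hL hp) h1 h2 hq.1 (hq.2 p hmin.1)
  refine ⟨p, lam, ⟨hmin, huniq⟩, ⟨hL, hp, fun q mu hq hqK => ?_⟩, hL.classically,
    fun k hb => hL.contDiffOn hb, hL.hasDerivWithinAt_design_zero, fun i => norm_state_le (hL.1 i)⟩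
  have hqp : q = p := huniq q (hq.isMinimizer hε hγ0 (hM ε γ q mu hq hqK) h1 h2)
  subst hqp
  exact ⟨rfl, multiplier_unique hK hKcp hL.2.1 hq.2.1 hp⟩
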